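/- For a finite subset $A$ of an additive abelian group and an integer $k\ge 2$, let $kA=\{a_1+\dots+a_k : a_1,\dots,a_k\in A\}$ be the $k$-fold sumset and let $$E_k(A)=\bigl|\{(a_1,\dots,a_{2k})\in A^{2k} : a_1+\dots+a_k=a_{k+1}+\dots+a_{2k}\}\bigr|$$ be the $k$-additive energy of $A$; write $E(A)=E_2(A)$ for the additive energy. Let $d\ge 1$, $k\ge 2$, and $p=\log_{\frac{k+1}{2}}\binom{2k}{k}$, and regard $\{0,1\}^d$ as a subset of $\mathbb{Z}^d$. Then, for every nonempty $A\subseteq\{0,1\}^d$, $$E_k(A)\le\left(\frac{|kA|}{|A|}\right)^{p}.$$ Moreover, $p$ cannot be replaced by a smaller quantity: for every real $q<p$ there is a nonempty $A\subseteq\{0,1\}^d$ with $E_k(A)>\left(|kA|/|A|\right)^{q}$. In particular, for every nonempty $A\subseteq\{0,1\}^d$, $$E(A)\le\left(\frac{|A+A|}{|A|}\right)^{\log_{3/2}6}.$$ -/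

import Mathlib

open scoped Pointwise

/-- The discrete cube `{0,1}^d`, as a finite subset of `ℤ^d`. -/
def discreteCube (d : ℕ) : Finset (Fin d → ℤ) :=
  Fintype.piFinset fun _ => {0, 1}

/-- The `k`-fold sumset `kA = {a₁ + ⋯ + a_k : a₁, …, a_k ∈ A}` (not the dilate of `A`). -/
def iteratedSumset {G : Type*} [AddCommGroup G] [DecidableEq G] (k : ℕ) (A : Finset G) :
    Finset G :=
  (Fintype.piFinset fun _ : Fin k => A).image fun a => ∑ i, a i

/-- The `k`-additive energy `E_k(A)`: the number of `2k`-tuples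
`(a₁, …, a_k, b₁, …, b_k)` of elements of `A` with `a₁ + ⋯ + a_k = b₁ + ⋯ + b_k`. -/
def kAdditiveEnergy {G : Type*} [AddCommGroup G] [DecidableEq G] (k : ℕ) (A : Finset G) : ℕ :=
  (((Fintype.piFinset fun _ : Fin k => A) ×ˢ (Fintype.piFinset fun _ : Fin k => A)).filter
    fun x => ∑ i, x.1 i = ∑ i, x.2 i).card

/-!
For `A ⊆ {0,1}^d` both `|kA| ≥ |A| ^ log₂ (k + 1)` and `E_k(A) ≤ |A| ^ log₂ (2k choose k)` hold,
with equality for the whole cube; the theorem follows by eliminating `|A|`. Both bounds are proved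
by induction on `d`, slicing `A` along the first coordinate.

For the sumset one proves the bound for `A₁ + ⋯ + A_k` with `k` different summands. If the two
slices of `Aᵢ` have union `Cᵢ` and intersection `Dᵢ`, then every point of
`D₁ + ⋯ + D_m + C_{m+1} + ⋯ + C_k` has more than `m` lifts to the sumset, so that the inductive
step is the numerical inequality
`∏_i (cᵢ + dᵢ) ^ q ≤ ∑_m ∏_{i ≤ m} dᵢ ^ q ∏_{i > m} cᵢ ^ q` with `q = log₂ (k + 1) / k`,
where `cᵢ = |Cᵢ|` and `dᵢ = |Dᵢ|`. Equating the ratios `dᵢ / cᵢ` is the worst case, and for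
equal ratios the substitution `u = exp (-2 x)` turns it into the convexity of `x coth x`.

The energy is the `2k`-th moment of the exponential sum of `A`. Integrating out the first variable
and applying Hölder, the inductive step is the two-point inequality
`∑_j (k choose j)² a ^ (k - j) b ^ j ≤ (a ^ (k / p) + b ^ (k / p)) ^ p` with
`p = log₂ (2k choose k)`, an equality at `a = b`. In the variable `x = log (b / a)` the derivative
of the logarithmic gap between the two sides changes sign only once for `x < 0`: the left side
satisfies a second order linear equation, by which the numerator of that derivative has, at each of
its zeros, slope of the sign of a constant minus a strictly monotone ratio of hyperbolic sines.
-/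

/-! ### Convexity of `τ coth τ` -/

/-- The function `τ ↦ τ coth τ`, with value `0` at `τ = 0` (division by zero); only `0 < τ` is
used. It is `τ` times the logarithmic derivative of `sinh`. -/
noncomputable def mulCoth (τ : ℝ) : ℝ :=
  τ * Real.cosh τ / Real.sinh τ

theorem sinh_le_mul_cosh {τ : ℝ} (hτ : 0 ≤ τ) : Real.sinh τ ≤ τ * Real.cosh τ := by
  have hderiv : ∀ x, HasDerivAt (fun x => x * Real.cosh x - Real.sinh x) (x * Real.sinh x) x :=
    fun x => (((hasDerivAt_id' x).mul (Real.hasDerivAt_cosh x)).sub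
      (Real.hasDerivAt_sinh x)).congr_deriv (by ring)
  have hmono := monotoneOn_of_deriv_nonneg (convex_Ici 0)
    (HasDerivAt.continuousOn fun x _ => hderiv x)
    (fun x _ => (hderiv x).differentiableAt.differentiableWithinAt) fun x hx => by
      rw [(hderiv x).deriv]
      have hx : 0 < x := by simpa using hx
      exact mul_nonneg hx.le (Real.sinh_nonneg_iff.2 hx.le)
  simpa using hmono Set.self_mem_Ici hτ hτ

theorem lt_sinh_mul_cosh {τ : ℝ} (hτ : 0 < τ) : τ < Real.sinh τ * Real.cosh τ := by
  have hsinh : τ < Real.sinh τ := Real.self_lt_sinh_iff.2 hτ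
  nlinarith [Real.one_le_cosh τ]

theorem hasDerivAt_mulCoth {τ : ℝ} (hτ : 0 < τ) :
    HasDerivAt mulCoth ((Real.sinh τ * Real.cosh τ - τ) / Real.sinh τ ^ 2) τ := by
  refine (((hasDerivAt_id' τ).mul (Real.hasDerivAt_cosh τ)).div (Real.hasDerivAt_sinh τ)
    (Real.sinh_pos_iff.2 hτ).ne').congr_deriv ?_
  simp only [Pi.mul_apply]
  congr 1
  linear_combination -τ * Real.cosh_sq_sub_sinh_sq τ

theorem hasDerivAt_deriv_mulCoth {τ : ℝ} (hτ : 0 < τ) :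
    HasDerivAt (fun τ => (Real.sinh τ * Real.cosh τ - τ) / Real.sinh τ ^ 2)
      (2 * (τ * Real.cosh τ - Real.sinh τ) / Real.sinh τ ^ 3) τ := by
  have hsinh : Real.sinh τ ≠ 0 := (Real.sinh_pos_iff.2 hτ).ne'
  refine ((((Real.hasDerivAt_sinh τ).mul (Real.hasDerivAt_cosh τ)).sub (hasDerivAt_id' τ)).div
    ((Real.hasDerivAt_sinh τ).pow 2) (pow_ne_zero 2 hsinh)).congr_deriv ?_
  simp only [Pi.mul_apply, Pi.sub_apply, Pi.pow_apply]
  field_simp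
  linear_combination -Real.sinh τ ^ 2 * Real.cosh_sq_sub_sinh_sq τ

theorem strictMonoOn_mulCoth : StrictMonoOn mulCoth (Set.Ioi 0) := by
  refine strictMonoOn_of_deriv_pos (convex_Ioi 0)
    (HasDerivAt.continuousOn fun τ hτ => hasDerivAt_mulCoth hτ) fun τ hτ => ?_
  rw [interior_Ioi, Set.mem_Ioi] at hτ
  rw [(hasDerivAt_mulCoth hτ).deriv]
  exact div_pos (sub_pos.2 (lt_sinh_mul_cosh hτ)) (pow_pos (Real.sinh_pos_iff.2 hτ) 2)

theorem convexOn_mulCoth : ConvexOn ℝ (Set.Ioi 0) mulCoth := by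
  refine convexOn_of_hasDerivWithinAt2_nonneg (convex_Ioi 0)
    (HasDerivAt.continuousOn fun τ hτ => hasDerivAt_mulCoth hτ)
    (fun τ hτ => (hasDerivAt_mulCoth ?_).hasDerivWithinAt)
    (fun τ hτ => (hasDerivAt_deriv_mulCoth ?_).hasDerivWithinAt) fun τ hτ => ?_
  all_goals rw [interior_Ioi, Set.mem_Ioi] at hτ
  · exact hτ
  · exact hτ
  · have := sub_nonneg.2 (sinh_le_mul_cosh hτ.le)
    have := Real.sinh_pos_iff.2 hτ
    positivity

theorem hasDerivAt_log_sinh_mul {a x : ℝ} (ha : 0 < a) (hx : 0 < x) :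
    HasDerivAt (fun x => Real.log (Real.sinh (a * x))) (mulCoth (a * x) / x) x := by
  have hsinh : Real.sinh (a * x) ≠ 0 := (Real.sinh_pos_iff.2 (mul_pos ha hx)).ne'
  refine (((hasDerivAt_id' x).const_mul a).sinh.log hsinh).congr_deriv ?_
  rw [mulCoth]
  field_simp

theorem strictAntiOn_sinh_mul_div_sinh {μ : ℝ} (h0 : 0 < μ) (h1 : μ < 1) :
    StrictAntiOn (fun x => Real.sinh (μ * x) / Real.sinh x) (Set.Ioi 0) := by
  have hderiv : ∀ x ∈ Set.Ioi (0 : ℝ),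
      HasDerivAt (fun x => Real.log (Real.sinh (μ * x)) - Real.log (Real.sinh (1 * x)))
        (mulCoth (μ * x) / x - mulCoth (1 * x) / x) x := fun x hx =>
    (hasDerivAt_log_sinh_mul h0 hx).sub (hasDerivAt_log_sinh_mul one_pos hx)
  have hlog := strictAntiOn_of_hasDerivWithinAt_neg (convex_Ioi 0)
    (HasDerivAt.continuousOn hderiv)
    (fun x hx => (hderiv x (interior_subset hx)).hasDerivWithinAt) fun x hx => by
      rw [interior_Ioi] at hx
      rw [← sub_div, one_mul]
      exact div_neg_of_neg_of_pos (sub_neg.2 <| strictMonoOn_mulCoth (mul_pos h0 hx) hx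
        (mul_lt_of_lt_one_left hx h1)) hx
  intro x hx y hy hxy
  have hsinh : ∀ z ∈ Set.Ioi (0 : ℝ), 0 < Real.sinh (μ * z) ∧ 0 < Real.sinh z := fun z hz =>
    ⟨Real.sinh_pos_iff.2 (mul_pos h0 hz), Real.sinh_pos_iff.2 hz⟩
  have hquot := hlog hx hy hxy
  simp only [one_mul] at hquot
  rw [← Real.log_div (hsinh y hy).1.ne' (hsinh y hy).2.ne',
    ← Real.log_div (hsinh x hx).1.ne' (hsinh x hx).2.ne'] at hquot
  exact (Real.log_lt_log_iff (div_pos (hsinh y hy).1 (hsinh y hy).2)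
    (div_pos (hsinh x hx).1 (hsinh x hx).2)).1 hquot

theorem antitoneOn_log_sinh_sub {a b α β : ℝ} (ha : 0 < a) (hb : 0 < b) (hα : 0 ≤ α)
    (hβ : 0 ≤ β) (hαβ : α + β = 1) :
    AntitoneOn (fun x => Real.log (Real.sinh ((α * a + β * b) * x)) -
      (α * Real.log (Real.sinh (a * x)) + β * Real.log (Real.sinh (b * x)))) (Set.Ioi 0) := by
  have hab : 0 < α * a + β * b := convex_Ioi (0 : ℝ) ha hb hα hβ hαβ
  have hderiv := fun x (hx : x ∈ Set.Ioi (0 : ℝ)) => (hasDerivAt_log_sinh_mul hab hx).sub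
    (((hasDerivAt_log_sinh_mul ha hx).const_mul α).add
      ((hasDerivAt_log_sinh_mul hb hx).const_mul β))
  refine antitoneOn_of_hasDerivWithinAt_nonpos (convex_Ioi 0) (HasDerivAt.continuousOn hderiv)
    (fun x hx => (hderiv x (interior_subset hx)).hasDerivWithinAt) fun x hx => ?_
  rw [interior_Ioi] at hx
  have hconvex := convexOn_mulCoth.2 (mul_pos ha hx) (mul_pos hb hx) hα hβ hαβ
  simp only [smul_eq_mul, ← mul_assoc, ← add_mul] at hconvex
  calc _ = (mulCoth ((α * a + β * b) * x) -
        (α * mulCoth (a * x) + β * mulCoth (b * x))) / x := by ring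
    _ ≤ 0 := div_nonpos_of_nonpos_of_nonneg (sub_nonpos.2 hconvex) (Set.mem_Ioi.1 hx).le

theorem hasDerivAt_log_sinh_sub (α β : ℝ) {x : ℝ} (hx : 0 < x) :
    HasDerivAt (fun x => Real.log (Real.sinh (1 * x)) - (α * x + β * Real.log x))
      ((mulCoth x - (α * x + β)) / x) x := by
  refine ((hasDerivAt_log_sinh_mul one_pos hx).sub (((hasDerivAt_id' x).const_mul α).add
    ((Real.hasDerivAt_log hx.ne').const_mul β))).congr_deriv ?_
  field_simp

theorem le_log_sinh_sub_of_le_mulCoth {α β a b : ℝ} (ha : 0 < a) (hab : a ≤ b)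
    (h : ∀ x ∈ Set.Ioo a b, α * x + β ≤ mulCoth x) :
    α * (b - a) + β * (Real.log b - Real.log a) ≤
      Real.log (Real.sinh b) - Real.log (Real.sinh a) := by
  have hderiv := fun x (hx : x ∈ Set.Icc a b) =>
    hasDerivAt_log_sinh_sub α β (ha.trans_le hx.1)
  have hmono := monotoneOn_of_hasDerivWithinAt_nonneg (convex_Icc a b)
    (HasDerivAt.continuousOn hderiv)
    (fun x hx => (hderiv x (interior_subset hx)).hasDerivWithinAt) fun x hx => by
      rw [interior_Icc] at hx
      exact div_nonneg (sub_nonneg.2 (h x hx)) (ha.trans hx.1).le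
  have := hmono (Set.left_mem_Icc.2 hab) (Set.right_mem_Icc.2 hab) hab
  simp only [one_mul] at this
  linarith

theorem log_sinh_sub_le_of_mulCoth_le {α β a b : ℝ} (ha : 0 < a) (hab : a ≤ b)
    (h : ∀ x ∈ Set.Ioo a b, mulCoth x ≤ α * x + β) :
    Real.log (Real.sinh b) - Real.log (Real.sinh a) ≤
      α * (b - a) + β * (Real.log b - Real.log a) := by
  have hderiv := fun x (hx : x ∈ Set.Icc a b) =>
    hasDerivAt_log_sinh_sub α β (ha.trans_le hx.1)
  have hanti := antitoneOn_of_hasDerivWithinAt_nonpos (convex_Icc a b)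
    (HasDerivAt.continuousOn hderiv)
    (fun x hx => (hderiv x (interior_subset hx)).hasDerivWithinAt) fun x hx => by
      rw [interior_Icc] at hx
      exact div_nonpos_of_nonpos_of_nonneg (sub_nonpos.2 (h x hx)) (ha.trans hx.1).le
  have := hanti (Set.left_mem_Icc.2 hab) (Set.right_mem_Icc.2 hab) hab
  simp only [one_mul] at this
  linarith

theorem mul_log_sinh_sub_le {z y y' w p : ℝ} (hz : 0 < z) (hzy : z ≤ y) (hyy' : y < y')
    (hy'w : y' ≤ w) (hlin : w - z = p * (y' - y))
    (hlog : Real.log w - Real.log z = p * (Real.log y' - Real.log y)) :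
    p * (Real.log (Real.sinh y') - Real.log (Real.sinh y)) ≤
      Real.log (Real.sinh w) - Real.log (Real.sinh z) := by
  have hy : 0 < y := hz.trans_le hzy
  have hy' : 0 < y' := hy.trans hyy'
  have hlen : 0 < y' - y := sub_pos.2 hyy'
  have hp : 1 ≤ p := by
    by_contra! hp
    nlinarith [mul_lt_mul_of_pos_right hp hlen]
  -- `x ↦ α x + β` is the chord of the convex function `mulCoth` over `[y, y']`.
  obtain ⟨α, hα⟩ : ∃ α, α * (y' - y) = mulCoth y' - mulCoth y :=
    ⟨_, div_mul_cancel₀ _ hlen.ne'⟩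
  obtain ⟨β, hβ⟩ : ∃ β, β = mulCoth y - α * y := ⟨_, rfl⟩
  have hleft := le_log_sinh_sub_of_le_mulCoth (α := α) (β := β) hz hzy fun x hx => by
    have hchord := convexOn_mulCoth.secant_mono_aux1 (hz.trans hx.1) hy' hx.2 hyy'
    refine le_of_mul_le_mul_left ?_ hlen
    linear_combination hchord + (x - y) * hα + (y' - y) * hβ
  have hmid := log_sinh_sub_le_of_mulCoth_le (α := α) (β := β) hy hyy'.le fun x hx => by
    have hchord := convexOn_mulCoth.secant_mono_aux1 hy hy' hx.1 hx.2
    refine le_of_mul_le_mul_left ?_ hlen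
    linear_combination hchord + (y - x) * hα - (y' - y) * hβ
  have hright := le_log_sinh_sub_of_le_mulCoth (α := α) (β := β) hy' hy'w fun x hx => by
    have hchord := convexOn_mulCoth.secant_mono_aux1 hy (hy'.trans hx.1) hyy' hx.1
    refine le_of_mul_le_mul_left ?_ hlen
    linear_combination hchord + (x - y) * hα + (y' - y) * hβ
  have hexcess := mul_le_mul_of_nonneg_left hmid (sub_nonneg.2 hp)
  linear_combination hleft + hright + hexcess - α * hlin - β * hlog

/-! ### The multi-point inequality for sumsets -/

theorem log_geom_sum_exp {n : ℕ} (hn : n ≠ 0) {x : ℝ} (hx : 0 < x) :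
    Real.log (∑ j ∈ Finset.range n, Real.exp (-2 * x) ^ j) =
      Real.log (Real.sinh (n * x)) - Real.log (Real.sinh x) - (n - 1) * x := by
  have hsinh : 0 < Real.sinh x := Real.sinh_pos_iff.2 hx
  have hsinh' : 0 < Real.sinh (n * x) := Real.sinh_pos_iff.2 (by positivity)
  have hexp : ∀ y, Real.exp (-y) * Real.sinh y = (1 - Real.exp (-2 * y)) / 2 := fun y => by
    rw [Real.sinh_eq, mul_div_assoc', mul_sub, ← Real.exp_add, ← Real.exp_add]
    ring_nf
    simp
  have hpow : Real.exp (-2 * x) ^ n = Real.exp (-2 * (n * x)) := by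
    rw [← Real.exp_nat_mul]; ring_nf
  have hsplit : Real.exp (-(n * x)) = Real.exp (-((n - 1) * x)) * Real.exp (-x) := by
    rw [← Real.exp_add]; ring_nf
  have hgeom : (∑ j ∈ Finset.range n, Real.exp (-2 * x) ^ j) * Real.sinh x =
      Real.exp (-((n - 1) * x)) * Real.sinh (n * x) := by
    have h := geom_sum_mul_neg (Real.exp (-2 * x)) n
    refine mul_left_cancel₀ (Real.exp_pos (-x)).ne' ?_
    linear_combination (∑ j ∈ Finset.range n, Real.exp (-2 * x) ^ j) * hexp x + h / 2
      - hexp (n * x) - hpow / 2 + Real.sinh (n * x) * hsplit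
  rw [eq_div_of_mul_eq hsinh.ne' hgeom, Real.log_div (by positivity) hsinh.ne',
    Real.log_mul (Real.exp_pos _).ne' hsinh'.ne', Real.log_exp]
  ring

theorem exists_exp_neg_two_mul_eq {u : ℝ} (hu : u ∈ Set.Ioo 0 1) :
    ∃ x > 0, Real.exp (-2 * x) = u :=
  ⟨-Real.log u / 2, by linarith [Real.log_neg hu.1 hu.2], by
    rw [show -2 * (-Real.log u / 2) = Real.log u by ring, Real.exp_log hu.1]⟩

theorem continuousOn_log_geom_sum (n : ℕ) :
    ContinuousOn (fun u : ℝ => Real.log (∑ j ∈ Finset.range (n + 1), u ^ j)) (Set.Icc 0 1) :=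
  ContinuousOn.log (by fun_prop) fun _ hu => (geom_sum_pos hu.1 n.succ_ne_zero).ne'

theorem monotoneOn_Icc_of_monotoneOn_Ioo {f : ℝ → ℝ} {a b : ℝ} (hab : a < b)
    (hmono : MonotoneOn f (Set.Ioo a b)) (hcont : ContinuousOn f (Set.Icc a b)) :
    MonotoneOn f (Set.Icc a b) := by
  have hleft : ClusterPt a (Filter.principal (Set.Ioo a b)) :=
    mem_closure_iff_clusterPt.1 (by rw [closure_Ioo hab.ne]; exact Set.left_mem_Icc.2 hab.le)
  have hright : ClusterPt b (Filter.principal (Set.Ico a b)) :=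
    mem_closure_iff_clusterPt.1 (by rw [closure_Ico hab.ne]; exact Set.right_mem_Icc.2 hab.le)
  have hIco := hmono.insert_of_continuousWithinAt hleft
    ((hcont a (Set.left_mem_Icc.2 hab.le)).mono Set.Ioo_subset_Icc_self)
  rw [Set.Ioo_insert_left hab] at hIco
  have hIcc := hIco.insert_of_continuousWithinAt hright
    ((hcont b (Set.right_mem_Icc.2 hab.le)).mono Set.Ico_subset_Icc_self)
  rwa [Set.Ico_insert_right hab.le] at hIcc

theorem monotoneOn_log_geom_sum_sub {r k : ℕ} (hrk : r ≤ k) :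
    MonotoneOn (fun u : ℝ => k * Real.log (∑ j ∈ Finset.range (r + 1), u ^ j) -
      r * Real.log (∑ j ∈ Finset.range (k + 1), u ^ j)) (Set.Icc 0 1) := by
  refine monotoneOn_Icc_of_monotoneOn_Ioo one_pos (fun u hu v hv huv => ?_)
    (((continuousOn_log_geom_sum r).const_mul _).sub ((continuousOn_log_geom_sum k).const_mul _))
  obtain rfl | hk := k.eq_zero_or_pos
  · obtain rfl : r = 0 := Nat.le_zero.1 hrk
    simp
  obtain ⟨x, hx, rfl⟩ := exists_exp_neg_two_mul_eq hu
  obtain ⟨y, hy, rfl⟩ := exists_exp_neg_two_mul_eq hv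
  have hyx : y ≤ x := by linarith [Real.exp_le_exp.1 huv]
  have hk : (0 : ℝ) < k := Nat.cast_pos.2 hk
  obtain ⟨α, hα⟩ : ∃ α, α = (r / k : ℝ) := ⟨_, rfl⟩
  have hα1 : α ≤ 1 := hα ▸ div_le_one_of_le₀ (Nat.cast_le.2 hrk) hk.le
  have hkα : k * α = r := by rw [hα, mul_div_cancel₀ _ hk.ne']
  have hanti := antitoneOn_log_sinh_sub (a := k + 1) (b := 1) (by positivity) one_pos
    (hα ▸ by positivity) (sub_nonneg.2 hα1) (add_sub_cancel α 1) hy hx hyx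
  rw [show α * (k + 1) + (1 - α) * 1 = r + 1 by linear_combination hkα] at hanti
  simp only [log_geom_sum_exp (Nat.succ_ne_zero _) hx, log_geom_sum_exp (Nat.succ_ne_zero _) hy]
  simp only [one_mul] at hanti
  push_cast
  linear_combination (k : ℝ) * hanti + (Real.log (Real.sinh ((k + 1) * x)) -
    Real.log (Real.sinh x) - Real.log (Real.sinh ((k + 1) * y)) + Real.log (Real.sinh y)) * hkα

theorem four_pow_le_succ_pow_succ (k : ℕ) : 4 ^ k ≤ (k + 1) ^ (k + 1) := by
  obtain hk | hk := lt_or_ge k 3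
  · interval_cases k <;> norm_num
  · exact (Nat.pow_le_pow_right (by norm_num) k.le_succ).trans
      (Nat.pow_le_pow_left (by omega) _)

theorem logb_two_succ_le (k : ℕ) : Real.logb 2 (k + 1) ≤ k := by
  rw [Real.logb_le_iff_le_rpow one_lt_two (by positivity), Real.rpow_natCast]
  exact_mod_cast Nat.succ_le_of_lt k.lt_two_pow_self

theorem two_mul_le_succ_mul_logb (k : ℕ) : 2 * k ≤ (k + 1) * Real.logb 2 (k + 1) := by
  have h := Real.logb_le_logb_of_le one_lt_two (by positivity)
    (Nat.cast_le (α := ℝ).2 (four_pow_le_succ_pow_succ k))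
  push_cast at h
  rw [show (4 : ℝ) = 2 ^ 2 by norm_num, ← pow_mul, Real.logb_pow, Real.logb_pow,
    Real.logb_self_eq_one one_lt_two, mul_one] at h
  exact_mod_cast h

theorem mul_log_one_add_exp_le_log_geom_sum {k : ℕ} (hk : 1 ≤ k) {z : ℝ} (hz : 0 < z) :
    Real.logb 2 (k + 1) * Real.log (1 + Real.exp (-2 * z * (k / Real.logb 2 (k + 1)))) ≤
      Real.log (∑ j ∈ Finset.range (k + 1), Real.exp (-2 * z) ^ j) := by
  have hk : (1 : ℝ) ≤ k := Nat.one_le_cast.2 hk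
  have hp0 : 0 < Real.logb 2 (k + 1) := Real.logb_pos one_lt_two (by linarith)
  have hlog : Real.log (k + 1) = Real.logb 2 (k + 1) * Real.log 2 := by
    rw [Real.logb, div_mul_cancel₀ _ (Real.log_pos one_lt_two).ne']
  set p := Real.logb 2 (k + 1)
  obtain ⟨y, hy⟩ : ∃ y, y = k * z / p := ⟨_, rfl⟩
  have hpy : p * y = k * z := by rw [hy]; field_simp
  have hy0 : 0 < y := by rw [hy]; positivity
  have hsinh := mul_log_sinh_sub_le (p := p) hz (y := y) (y' := 2 * y) (w := (k + 1) * z)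
    (by rw [hy, le_div_iff₀ hp0]; nlinarith [logb_two_succ_le k]) (by linarith)
    (by rw [hy, mul_div_assoc', div_le_iff₀ hp0]; nlinarith [two_mul_le_succ_mul_logb k])
    (by linarith)
    (by rw [Real.log_mul (by positivity) hz.ne', Real.log_mul two_ne_zero hy0.ne', hlog]; ring)
  have hlhs := log_geom_sum_exp two_ne_zero hy0
  have hrhs := log_geom_sum_exp k.succ_ne_zero hz
  rw [Finset.sum_range_succ, Finset.sum_range_one, pow_zero, pow_one] at hlhs
  push_cast at hlhs hrhs
  rw [show -2 * z * (k / p) = -2 * y by rw [hy]; ring, hlhs, hrhs]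
  linarith

theorem one_add_rpow_le_geom_sum {k : ℕ} (hk : 1 ≤ k) {u : ℝ} (hu : u ∈ Set.Icc 0 1) :
    (1 + u ^ (k / Real.logb 2 (k + 1))) ^ Real.logb 2 (k + 1) ≤
      ∑ j ∈ Finset.range (k + 1), u ^ j := by
  have hp : 0 < Real.logb 2 (k + 1) :=
    Real.logb_pos one_lt_two (lt_add_of_pos_left 1 (Nat.cast_pos.2 hk))
  set p := Real.logb 2 (k + 1)
  have hexp : (0 : ℝ) ≤ k / p := by positivity
  have hIoo : ∀ u ∈ Set.Ioo (0 : ℝ) 1,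
      (1 + u ^ (k / p)) ^ p ≤ ∑ j ∈ Finset.range (k + 1), u ^ j := fun u hu => by
    obtain ⟨z, hz, rfl⟩ := exists_exp_neg_two_mul_eq hu
    rw [← Real.exp_mul, ← Real.log_le_log_iff (by positivity)
      (geom_sum_pos (Real.exp_pos _).le k.succ_ne_zero), Real.log_rpow (by positivity)]
    exact mul_log_one_add_exp_le_log_geom_sum hk hz
  have hleft : Continuous fun u : ℝ => (1 + u ^ (k / p)) ^ p :=
    ((Real.continuous_rpow_const hexp).const_add 1).rpow_const fun _ => Or.inr hp.le
  have hright : Continuous fun u : ℝ => ∑ j ∈ Finset.range (k + 1), u ^ j := by fun_prop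
  rw [← closure_Ioo zero_ne_one] at hu
  exact le_on_closure hIoo hleft.continuousOn hright.continuousOn hu

/-- The sum `1 + u₀ + u₀ u₁ + ⋯ + u₀ ⋯ uₙ₋₁` of the products of the initial segments of `u`. -/
def sumPrefixProd {n : ℕ} (u : Fin n → ℝ) : ℝ :=
  ∑ j ∈ Finset.range (n + 1), ∏ i : Fin n, if (i : ℕ) < j then u i else 1

theorem sumPrefixProd_succ {n : ℕ} (u : Fin (n + 1) → ℝ) :
    sumPrefixProd u = 1 + u 0 * sumPrefixProd (Fin.tail u) := by
  rw [sumPrefixProd, Finset.sum_range_succ', add_comm]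
  simp [sumPrefixProd, Fin.prod_univ_succ, Finset.mul_sum, Fin.tail]

theorem one_le_sumPrefixProd {n : ℕ} {u : Fin n → ℝ} (hu : ∀ i, 0 ≤ u i) :
    1 ≤ sumPrefixProd u := by
  induction n with
  | zero => simp [sumPrefixProd]
  | succ n ih =>
    rw [sumPrefixProd_succ]
    exact le_add_of_nonneg_right
      (mul_nonneg (hu 0) (zero_le_one.trans (ih fun i => hu i.succ)))

theorem monotoneOn_pow_div_geom_sum (r : ℕ) :
    MonotoneOn (fun u : ℝ => u ^ r / ∑ j ∈ Finset.range (r + 1), u ^ j) (Set.Ici 0) := by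
  intro b (hb : 0 ≤ b) a (ha : 0 ≤ a) hba
  beta_reduce
  rw [div_le_div_iff₀ (geom_sum_pos hb r.succ_ne_zero) (geom_sum_pos ha r.succ_ne_zero),
    Finset.mul_sum, Finset.mul_sum]
  refine Finset.sum_le_sum fun j hj => ?_
  obtain ⟨m, rfl⟩ := Nat.exists_eq_add_of_le (Finset.mem_range_succ_iff.1 hj)
  calc b ^ (j + m) * a ^ j = b ^ j * a ^ j * b ^ m := by ring
    _ ≤ b ^ j * a ^ j * a ^ m := by gcongr
    _ = a ^ (j + m) * b ^ j := by ring

theorem monotoneOn_log_geom_sum_add_sub {r k : ℕ} (hrk : r ≤ k) {T : ℝ} (hT : 1 ≤ T) :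
    MonotoneOn (fun u : ℝ => k * Real.log (∑ j ∈ Finset.range r, u ^ j + u ^ r * T) -
      r * Real.log (∑ j ∈ Finset.range (k + 1), u ^ j)) (Set.Icc 0 1) := by
  have hT : 0 ≤ T - 1 := sub_nonneg.2 hT
  have hsplit : ∀ u ∈ Set.Icc (0 : ℝ) 1, Real.log (∑ j ∈ Finset.range r, u ^ j + u ^ r * T) =
      Real.log (∑ j ∈ Finset.range (r + 1), u ^ j) +
        Real.log (1 + (T - 1) * (u ^ r / ∑ j ∈ Finset.range (r + 1), u ^ j)) := fun u hu => by
    have hu0 : 0 ≤ u := hu.1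
    have hpos := geom_sum_pos hu0 r.succ_ne_zero
    rw [← Real.log_mul hpos.ne' (by positivity), mul_add, mul_left_comm,
      mul_div_cancel₀ _ hpos.ne', Finset.sum_range_succ]
    ring_nf
  intro b hb a ha hba
  have hb0 : 0 ≤ b := hb.1
  have hequal := monotoneOn_log_geom_sum_sub hrk hb ha hba
  have hratio := mul_le_mul_of_nonneg_left (monotoneOn_pow_div_geom_sum r hb.1 ha.1 hba) hT
  have hlog := mul_le_mul_of_nonneg_left
    (Real.log_le_log (by positivity) (add_le_add_right hratio 1)) (Nat.cast_nonneg (α := ℝ) k)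
  beta_reduce at hequal hlog ⊢
  rw [hsplit a ha, hsplit b hb]
  linarith

/- Lowering the common value `a` of the first `r` weights to the next weight `u 0` makes one more
weight equal, and by monotonicity this only strengthens the inequality. -/
theorem sum_log_geom_sum_le {n r : ℕ} {u : Fin n → ℝ} (hu : ∀ i, 0 ≤ u i) (hanti : Antitone u)
    {a : ℝ} (ha : a ∈ Set.Icc 0 1) (hua : ∀ i, u i ≤ a) :
    r * Real.log (∑ j ∈ Finset.range (r + n + 1), a ^ j) +
        ∑ i, Real.log (∑ j ∈ Finset.range (r + n + 1), u i ^ j) ≤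
      (r + n) * Real.log (∑ j ∈ Finset.range r, a ^ j + a ^ r * sumPrefixProd u) := by
  induction n generalizing r a with
  | zero => simp [sumPrefixProd, Finset.sum_range_succ]
  | succ n ih =>
    have hu0 : u 0 ∈ Set.Icc 0 1 := ⟨hu 0, (hua 0).trans ha.2⟩
    have htail := ih (r := r + 1) (u := Fin.tail u) (fun i => hu i.succ)
      (fun i j hij => hanti (Fin.succ_le_succ_iff.2 hij)) hu0 fun i => hanti (Fin.zero_le _)
    have hlower := monotoneOn_log_geom_sum_add_sub (k := r + (n + 1)) (Nat.le_add_right r _)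
      (one_le_sumPrefixProd hu) hu0 ha (hua 0)
    have hsum : ∑ j ∈ Finset.range (r + 1), u 0 ^ j + u 0 ^ (r + 1) * sumPrefixProd (Fin.tail u) =
        ∑ j ∈ Finset.range r, u 0 ^ j + u 0 ^ r * sumPrefixProd u := by
      rw [Finset.sum_range_succ, sumPrefixProd_succ]; ring
    rw [hsum, show r + 1 + n = r + (n + 1) by ring] at htail
    rw [Fin.sum_univ_succ]
    simp only [Fin.tail] at htail
    push_cast at htail hlower ⊢
    linarith

theorem prod_one_add_rpow_le_sumPrefixProd {k : ℕ} {t : Fin k → ℝ} (ht : ∀ i, t i ∈ Set.Icc 0 1)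
    (hanti : Antitone t) :
    ∏ i, (1 + t i) ^ (Real.logb 2 (k + 1) / k) ≤
      sumPrefixProd fun i => t i ^ (Real.logb 2 (k + 1) / k) := by
  obtain rfl | hk := k.eq_zero_or_pos
  · simp [sumPrefixProd]
  have hk0 : (0 : ℝ) < k := Nat.cast_pos.2 hk
  have hp : 0 < Real.logb 2 (k + 1) := Real.logb_pos one_lt_two (by linarith)
  set q := Real.logb 2 (k + 1) / k
  have hq : 0 < q := div_pos hp hk0
  have hu : ∀ i, t i ^ q ∈ Set.Icc 0 1 := fun i =>
    ⟨Real.rpow_nonneg (ht i).1 q, Real.rpow_le_one (ht i).1 (ht i).2 hq.le⟩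
  have hsum := sum_log_geom_sum_le (r := 0) (fun i => (hu i).1)
    (fun i j hij => Real.rpow_le_rpow (ht j).1 (hanti hij) hq.le)
    (Set.right_mem_Icc.2 zero_le_one) fun i => (hu i).2
  simp only [Nat.cast_zero, zero_mul, zero_add, Finset.range_zero, Finset.sum_empty, pow_zero,
    one_mul] at hsum
  have hpos : ∀ i, 0 < 1 + t i := fun i => by linarith [(ht i).1]
  have hone : ∀ i, Real.logb 2 (k + 1) * Real.log (1 + t i) ≤
      Real.log (∑ j ∈ Finset.range (k + 1), (t i ^ q) ^ j) := fun i => by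
    have h := one_add_rpow_le_geom_sum hk (hu i)
    rw [← Real.rpow_mul (ht i).1, div_mul_div_cancel₀ hk0.ne', div_self hp.ne',
      Real.rpow_one] at h
    rw [← Real.log_rpow (hpos i)]
    exact Real.log_le_log (Real.rpow_pos_of_pos (hpos i) _) h
  have hpos' : ∀ i, 0 < (1 + t i) ^ q := fun i => Real.rpow_pos_of_pos (hpos i) q
  rw [← Real.log_le_log_iff (Finset.prod_pos fun i _ => hpos' i)
    (zero_lt_one.trans_le (one_le_sumPrefixProd fun i => (hu i).1)),
    Real.log_prod fun i _ => (hpos' i).ne']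
  refine le_of_mul_le_mul_left (le_trans ?_ hsum) hk0
  rw [Finset.mul_sum]
  refine Finset.sum_le_sum fun i _ => le_trans (le_of_eq ?_) (hone i)
  rw [Real.log_rpow (hpos i), ← mul_assoc, mul_div_cancel₀ _ hk0.ne']

theorem prod_add_rpow_le_sum_prod_rpow {k : ℕ} {c d : Fin k → ℝ} (hc : ∀ i, 0 < c i)
    (hd : ∀ i, 0 ≤ d i) (hdc : ∀ i, d i ≤ c i) (hanti : Antitone fun i => d i / c i) :
    ∏ i, (c i + d i) ^ (Real.logb 2 (k + 1) / k) ≤ ∑ m ∈ Finset.range (k + 1),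
      ∏ i : Fin k, (if (i : ℕ) < m then d i else c i) ^ (Real.logb 2 (k + 1) / k) := by
  have ht : ∀ i, d i / c i ∈ Set.Icc 0 1 := fun i =>
    ⟨div_nonneg (hd i) (hc i).le, div_le_one_of_le₀ (hdc i) (hc i).le⟩
  have hmain := prod_one_add_rpow_le_sumPrefixProd ht hanti
  set q := Real.logb 2 (k + 1) / k
  calc ∏ i, (c i + d i) ^ q = (∏ i, c i ^ q) * ∏ i, (1 + d i / c i) ^ q := by
        rw [← Finset.prod_mul_distrib]
        refine Finset.prod_congr rfl fun i _ => ?_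
        rw [← Real.mul_rpow (hc i).le (by linarith [(ht i).1]), mul_add, mul_one,
          mul_div_cancel₀ _ (hc i).ne']
    _ ≤ (∏ i, c i ^ q) * sumPrefixProd fun i => (d i / c i) ^ q :=
        mul_le_mul_of_nonneg_left hmain
          (Finset.prod_nonneg fun i _ => Real.rpow_nonneg (hc i).le q)
    _ = _ := by
        rw [sumPrefixProd, Finset.mul_sum]
        refine Finset.sum_congr rfl fun m _ => ?_
        rw [← Finset.prod_mul_distrib]
        refine Finset.prod_congr rfl fun i _ => ?_
        split_ifs
        · rw [← Real.mul_rpow (hc i).le (ht i).1, mul_div_cancel₀ _ (hc i).ne']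
        · rw [mul_one]

/-! ### Sumsets in the cube -/

theorem mem_pointwise_sum {ι G : Type*} [Fintype ι] [AddCommMonoid G] [DecidableEq G]
    {A : ι → Finset G} {x : G} : x ∈ ∑ i, A i ↔ ∃ a : ι → G, (∀ i, a i ∈ A i) ∧ ∑ i, a i = x := by
  rw [← Finset.mem_coe, Finset.coe_sum, Set.mem_fintype_sum]
  simp only [Finset.mem_coe, exists_prop]

theorem iteratedSumset_eq_sum {G : Type*} [AddCommGroup G] [DecidableEq G] (k : ℕ)
    (A : Finset G) : iteratedSumset k A = ∑ _i : Fin k, A := by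
  ext x
  simp only [iteratedSumset, Finset.mem_image, Fintype.mem_piFinset, mem_pointwise_sum]

theorem iteratedSumset_eq_nsmul {G : Type*} [AddCommGroup G] [DecidableEq G] (k : ℕ)
    (A : Finset G) : iteratedSumset k A = k • A := by
  rw [iteratedSumset_eq_sum, Finset.sum_const, Finset.card_univ, Fintype.card_fin]

theorem sum_card_sub_one_lt_card_sum {ι G : Type*} [AddCommGroup G] [LinearOrder G]
    [IsOrderedAddMonoid G] (s : Finset ι) {S : ι → Finset G} (hS : ∀ i ∈ s, (S i).Nonempty) :
    ∑ i ∈ s, ((S i).card - 1) < (∑ i ∈ s, S i).card := by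
  classical
  induction s using Finset.induction_on with
  | empty => simp
  | insert i s hi ih =>
    have hs := ih fun j hj => hS j (Finset.mem_insert_of_mem hj)
    have hi_pos := (hS i (Finset.mem_insert_self i s)).card_pos
    have hcd := cauchy_davenport_add_of_linearOrder_isCancelAdd (hS i (Finset.mem_insert_self i s))
      (Finset.card_pos.1 (Nat.zero_lt_of_lt hs))
    rw [Finset.sum_insert hi, Finset.sum_insert hi]
    omega

theorem sum_card_le_card_of_lt_card_fiber {α β : Type*} [DecidableEq α] (f : β → α) (X : Finset β)
    (T : ℕ → Finset α) (n : ℕ)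
    (h : ∀ m < n, ∀ x ∈ T m, m < (X.filter fun y => f y = x).card) :
    ∑ m ∈ Finset.range n, (T m).card ≤ X.card := by
  set U := (Finset.range n).biUnion T
  have hT (m : ℕ) (hm : m ∈ Finset.range n) : (U.filter fun x => x ∈ T m) = T m := by
    rw [Finset.filter_mem_eq_inter, Finset.inter_eq_right]
    exact Finset.subset_biUnion_of_mem T hm
  calc ∑ m ∈ Finset.range n, (T m).card
      = ∑ m ∈ Finset.range n, (U.filter fun x => x ∈ T m).card :=
        Finset.sum_congr rfl fun m hm => by rw [hT m hm]
    _ = ∑ x ∈ U, ((Finset.range n).filter fun m => x ∈ T m).card :=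
        Finset.sum_card_bipartiteAbove_eq_sum_card_bipartiteBelow fun m x => x ∈ T m
    _ ≤ ∑ x ∈ U, (X.filter fun y => f y = x).card := by
        refine Finset.sum_le_sum fun x _ => ?_
        rw [← Finset.card_range (X.filter fun y => f y = x).card]
        refine Finset.card_le_card fun m hm => ?_
        rw [Finset.mem_filter, Finset.mem_range] at hm
        exact Finset.mem_range.2 (h m hm.1 x hm.2)
    _ = (X.filter fun y => f y ∈ U).card := Finset.sum_card_fiberwise_eq_card_filter X U f
    _ ≤ X.card := Finset.card_filter_le _ _

theorem cons_mem_discreteCube {d : ℕ} {e : ℤ} {x : Fin d → ℤ} :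
    (Fin.cons e x : Fin (d + 1) → ℤ) ∈ discreteCube (d + 1) ↔
      (e = 0 ∨ e = 1) ∧ x ∈ discreteCube d := by
  simp [discreteCube, Fin.forall_fin_succ]

/-- The slice of `A ⊆ ℤ^(d+1)` on which the first coordinate equals `e`, seen in `ℤ^d`. -/
noncomputable def slice {d : ℕ} (e : ℤ) (A : Finset (Fin (d + 1) → ℤ)) : Finset (Fin d → ℤ) :=
  A.preimage (Fin.cons (α := fun _ => ℤ) e) (Fin.cons_right_injective (α := fun _ => ℤ) e).injOn

theorem mem_slice {d : ℕ} {e : ℤ} {A : Finset (Fin (d + 1) → ℤ)} {x : Fin d → ℤ} :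
    x ∈ slice e A ↔ (Fin.cons e x : Fin (d + 1) → ℤ) ∈ A :=
  Finset.mem_preimage

theorem slice_subset_discreteCube {d : ℕ} {A : Finset (Fin (d + 1) → ℤ)}
    (hA : A ⊆ discreteCube (d + 1)) (e : ℤ) : slice e A ⊆ discreteCube d := fun _ hx =>
  (cons_mem_discreteCube.1 (hA (mem_slice.1 hx))).2

theorem sum_eq_sum_slice_add_sum_slice {d : ℕ} {M : Type*} [AddCommMonoid M]
    {A : Finset (Fin (d + 1) → ℤ)} (hA : A ⊆ discreteCube (d + 1)) (g : (Fin (d + 1) → ℤ) → M) :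
    ∑ a ∈ A, g a = ∑ x ∈ slice 0 A, g (Fin.cons 0 x) + ∑ x ∈ slice 1 A, g (Fin.cons 1 x) := by
  classical
  have hrange (e : ℤ) (y : Fin (d + 1) → ℤ) :
      y ∈ Set.range (Fin.cons (α := fun _ => ℤ) e) ↔ y 0 = e :=
    ⟨by rintro ⟨x, rfl⟩; rfl, fun h => ⟨Fin.tail y, h ▸ Fin.cons_self_tail y⟩⟩
  rw [slice, slice, Finset.sum_preimage' _ _ _ g, Finset.sum_preimage' _ _ _ g,
    ← Finset.sum_filter_add_sum_filter_not A fun y => y 0 = 0]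
  congr 1 <;> refine Finset.sum_congr (Finset.filter_congr fun y hy => ?_) fun _ _ => rfl
  · exact (hrange 0 y).symm
  · have hy0 : y 0 = 0 ∨ y 0 = 1 := by
      have hcons := hA hy
      rw [← Fin.cons_self_tail y, cons_mem_discreteCube] at hcons
      exact hcons.1
    rw [hrange]
    omega

theorem card_slice_union_add_card_slice_inter {d : ℕ} {A : Finset (Fin (d + 1) → ℤ)}
    (hA : A ⊆ discreteCube (d + 1)) :
    (slice 0 A ∪ slice 1 A).card + (slice 0 A ∩ slice 1 A).card = A.card := by
  have hcard := sum_eq_sum_slice_add_sum_slice hA fun _ => 1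
  simp only [← Finset.card_eq_sum_ones] at hcard
  rw [Finset.card_union_add_card_inter, hcard]

theorem card_sum_le_card_fiber_of_forall_cons_mem {d : ℕ} {ι : Type*} [Fintype ι]
    {A : ι → Finset (Fin (d + 1) → ℤ)} {S : ι → Finset ℤ} {a : ι → Fin d → ℤ}
    (h : ∀ i, ∀ e ∈ S i, (Fin.cons e (a i) : Fin (d + 1) → ℤ) ∈ A i) :
    (∑ i, S i).card ≤ ((∑ i, A i).filter fun y => Fin.tail y = ∑ i, a i).card := by
  refine Finset.card_le_card_of_injOn
    (fun t => (Fin.cons t (∑ i, a i) : Fin (d + 1) → ℤ)) (fun t ht => ?_)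
    (Fin.cons_left_injective (α := fun _ => ℤ) _).injOn
  obtain ⟨e, he, rfl⟩ := mem_pointwise_sum.1 (Finset.mem_coe.1 ht)
  refine Finset.mem_coe.2 (Finset.mem_filter.2 ⟨mem_pointwise_sum.2
    ⟨fun i => Fin.cons (e i) (a i), fun i => h i _ (he i), ?_⟩, rfl⟩)
  funext j
  refine Fin.cases ?_ (fun j => ?_) j <;> simp

theorem lt_card_fiber_of_mem_sum_slices {d k m : ℕ} (A : Fin k → Finset (Fin (d + 1) → ℤ))
    (hm : m ≤ k) {x : Fin d → ℤ}
    (hx : x ∈ ∑ i : Fin k, if (i : ℕ) < m then slice 0 (A i) ∩ slice 1 (A i)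
      else slice 0 (A i) ∪ slice 1 (A i)) :
    m < ((∑ i, A i).filter fun y => Fin.tail y = x).card := by
  obtain ⟨a, ha, rfl⟩ := mem_pointwise_sum.1 hx
  set S : Fin k → Finset ℤ := fun i =>
    ({0, 1} : Finset ℤ).filter fun e => (Fin.cons e (a i) : Fin (d + 1) → ℤ) ∈ A i with hS
  have hS_card (i : Fin k) (hi : (i : ℕ) < m) : (S i).card = 2 := by
    have hmem := ha i
    rw [if_pos hi, Finset.mem_inter, mem_slice, mem_slice] at hmem
    simp [hS, Finset.filter_insert, Finset.filter_singleton, hmem]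
  have hS_nonempty (i : Fin k) : (S i).Nonempty := by
    have hmem : a i ∈ slice 0 (A i) ∪ slice 1 (A i) := by
      have := ha i
      split_ifs at this
      · exact Finset.inter_subset_union this
      · exact this
    rw [Finset.mem_union, mem_slice, mem_slice] at hmem
    rcases hmem with h | h
    · exact ⟨0, Finset.mem_filter.2 ⟨by decide, h⟩⟩
    · exact ⟨1, Finset.mem_filter.2 ⟨by decide, h⟩⟩
  calc m = ∑ i : Fin k, if (i : ℕ) < m then 1 else 0 := by
        rw [← Finset.card_filter, Fin.card_filter_val_lt, min_eq_right hm]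
    _ ≤ ∑ i, ((S i).card - 1) := Finset.sum_le_sum fun i _ => by
        split_ifs with hi
        · rw [hS_card i hi]
        · exact Nat.zero_le _
    _ < (∑ i, S i).card := sum_card_sub_one_lt_card_sum _ fun i _ => hS_nonempty i
    _ ≤ _ := card_sum_le_card_fiber_of_forall_cons_mem fun _ _ he => (Finset.mem_filter.1 he).2

theorem prod_card_rpow_le_card_sum_of_antitone {d k : ℕ} {A : Fin k → Finset (Fin (d + 1) → ℤ)}
    (hA : ∀ i, A i ⊆ discreteCube (d + 1)) (hne : ∀ i, (A i).Nonempty)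
    (hanti : Antitone fun i => ((slice 0 (A i) ∩ slice 1 (A i)).card : ℝ)
      / (slice 0 (A i) ∪ slice 1 (A i)).card)
    (ih : ∀ B : Fin k → Finset (Fin d → ℤ), (∀ i, B i ⊆ discreteCube d) →
      ∏ i, ((B i).card : ℝ) ^ (Real.logb 2 (k + 1) / k) ≤ (∑ i, B i).card) :
    ∏ i, ((A i).card : ℝ) ^ (Real.logb 2 (k + 1) / k) ≤ (∑ i, A i).card := by
  set C := fun i => slice 0 (A i) ∪ slice 1 (A i)
  set D := fun i => slice 0 (A i) ∩ slice 1 (A i)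
  have hC (i) : C i ⊆ discreteCube d :=
    Finset.union_subset (slice_subset_discreteCube (hA i) 0) (slice_subset_discreteCube (hA i) 1)
  have hDC (i) : D i ⊆ C i := Finset.inter_subset_union
  have hcard (i) : (C i).card + (D i).card = (A i).card :=
    card_slice_union_add_card_slice_inter (hA i)
  have hC_pos (i) : 0 < (C i).card := by
    have := (hne i).card_pos
    have := Finset.card_le_card (hDC i)
    have := hcard i
    omega
  set T : ℕ → Fin k → Finset (Fin d → ℤ) := fun m i => if (i : ℕ) < m then D i else C i
  have hT (m : ℕ) (i) : T m i ⊆ discreteCube d := by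
    simp only [T]
    split_ifs
    · exact (hDC i).trans (hC i)
    · exact hC i
  calc ∏ i, ((A i).card : ℝ) ^ (Real.logb 2 (k + 1) / k)
      = ∏ i, ((C i).card + (D i).card : ℝ) ^ (Real.logb 2 (k + 1) / k) := by
        simp only [← hcard, Nat.cast_add]
    _ ≤ ∑ m ∈ Finset.range (k + 1), ∏ i, ((T m i).card : ℝ) ^ (Real.logb 2 (k + 1) / k) := by
        refine (prod_add_rpow_le_sum_prod_rpow (fun i => Nat.cast_pos.2 (hC_pos i))
          (fun i => Nat.cast_nonneg _) (fun i => Nat.cast_le.2 (Finset.card_le_card (hDC i)))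
          hanti).trans_eq ?_
        simp only [T, apply_ite Finset.card, Nat.cast_ite]
    _ ≤ ∑ m ∈ Finset.range (k + 1), ((∑ i, T m i).card : ℝ) :=
        Finset.sum_le_sum fun m _ => ih (T m) (hT m)
    _ ≤ (∑ i, A i).card := by
        exact_mod_cast sum_card_le_card_of_lt_card_fiber Fin.tail (∑ i, A i)
          (fun m => ∑ i, T m i) (k + 1) fun m hm x hx =>
            lt_card_fiber_of_mem_sum_slices A (Nat.lt_succ_iff.1 hm) hx

theorem prod_card_rpow_le_card_sum {d k : ℕ} {A : Fin k → Finset (Fin d → ℤ)}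
    (hA : ∀ i, A i ⊆ discreteCube d) :
    ∏ i, ((A i).card : ℝ) ^ (Real.logb 2 (k + 1) / k) ≤ (∑ i, A i).card := by
  have hq : 0 ≤ Real.logb 2 (k + 1) / k :=
    div_nonneg (Real.logb_nonneg one_lt_two (by simp)) (Nat.cast_nonneg k)
  have hempty {d : ℕ} {B : Fin k → Finset (Fin d → ℤ)} (hB : ¬∀ i, (B i).Nonempty) :
      ∏ i, ((B i).card : ℝ) ^ (Real.logb 2 (k + 1) / k) = 0 := by
    simp only [not_forall, Finset.not_nonempty_iff_eq_empty] at hB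
    obtain ⟨i, hi⟩ := hB
    have hk : (0 : ℝ) < k := Nat.cast_pos.2 i.pos
    have hlog : 0 < Real.logb 2 (k + 1) := Real.logb_pos one_lt_two (by linarith)
    refine Finset.prod_eq_zero (Finset.mem_univ i) ?_
    rw [hi, Finset.card_empty, Nat.cast_zero, Real.zero_rpow (div_pos hlog hk).ne']
  induction d with
  | zero =>
    by_cases hne : ∀ i, (A i).Nonempty
    · have hsum : 1 ≤ (∑ i, A i).card := by
        choose a ha using hne
        exact Finset.card_pos.2 ⟨_, mem_pointwise_sum.2 ⟨a, ha, rfl⟩⟩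
      calc ∏ i, ((A i).card : ℝ) ^ (Real.logb 2 (k + 1) / k)
          ≤ 1 := Finset.prod_le_one (fun i _ => by positivity) fun i _ =>
            Real.rpow_le_one (Nat.cast_nonneg _)
              (by exact_mod_cast Finset.card_le_one_of_subsingleton (A i)) hq
        _ ≤ (∑ i, A i).card := by exact_mod_cast hsum
    · exact (hempty hne).trans_le (Nat.cast_nonneg _)
  | succ d ih =>
    by_cases hne : ∀ i, (A i).Nonempty
    · set f : Fin k → ℝ := fun i => ((slice 0 (A i) ∩ slice 1 (A i)).card : ℝ)
        / (slice 0 (A i) ∪ slice 1 (A i)).card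
      set σ := Tuple.sort fun i => -f i
      have hanti : Antitone (f ∘ σ) := fun i j hij =>
        neg_le_neg_iff.1 (Tuple.monotone_sort (fun i => -f i) hij)
      have hsorted := prod_card_rpow_le_card_sum_of_antitone (fun i => hA (σ i))
        (fun i => hne (σ i)) hanti fun B hB => ih hB
      rwa [Equiv.sum_comp σ A,
        Equiv.prod_comp σ fun i => ((A i).card : ℝ) ^ (Real.logb 2 (k + 1) / k)] at hsorted
    · exact (hempty hne).trans_le (Nat.cast_nonneg _)

theorem card_rpow_le_card_iteratedSumset {d k : ℕ} (hk : k ≠ 0) {A : Finset (Fin d → ℤ)}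
    (hA : A ⊆ discreteCube d) :
    (A.card : ℝ) ^ Real.logb 2 (k + 1) ≤ (iteratedSumset k A).card := by
  have h := prod_card_rpow_le_card_sum (k := k) fun _ => hA
  rwa [Finset.prod_const, Finset.card_univ, Fintype.card_fin, ← Real.rpow_natCast,
    ← Real.rpow_mul (Nat.cast_nonneg _), div_mul_cancel₀ _ (Nat.cast_ne_zero.2 hk),
    ← iteratedSumset_eq_sum] at h

/-! ### The two-point inequality for energies -/

theorem exists_zero_deriv_nonneg {f : ℝ → ℝ} (hf : Differentiable ℝ f) {a b : ℝ} (hab : a ≤ b)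
    (ha : f a ≤ 0) (hb : 0 < f b) : ∃ x ∈ Set.Ico a b, f x = 0 ∧ 0 ≤ deriv f x := by
  by_contra! h
  have hle := image_le_of_deriv_right_lt_deriv_boundary (f := f) (f' := deriv f)
    (B := fun _ => 0) (B' := fun _ => 0) hf.continuous.continuousOn
    (fun x _ => (hf x).hasDerivAt.hasDerivWithinAt) ha (fun x => hasDerivAt_const x 0)
    (fun x hx h0 => h x hx h0) (Set.right_mem_Icc.2 hab)
  exact hb.not_ge hle

theorem exists_zero_deriv_nonpos {f : ℝ → ℝ} (hf : Differentiable ℝ f) {a b : ℝ} (hab : a ≤ b)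
    (ha : 0 ≤ f a) (hb : f b < 0) : ∃ x ∈ Set.Ico a b, f x = 0 ∧ deriv f x ≤ 0 := by
  obtain ⟨x, hx, h0, h1⟩ :=
    exists_zero_deriv_nonneg hf.neg hab (neg_nonpos.2 ha) (neg_pos.2 hb)
  rw [Pi.neg_apply, neg_eq_zero] at h0
  rw [deriv.neg, neg_nonneg] at h1
  exact ⟨x, hx, h0, h1⟩

theorem nonneg_of_tendsto_atBot_of_deriv_single_crossing {D N w : ℝ → ℝ} {c x : ℝ}
    (hw : ∀ x, 0 < w x) (hD : ∀ x, HasDerivAt D (N x / w x) x) (hN : Differentiable ℝ N)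
    (hlim : Filter.Tendsto D Filter.atBot (nhds 0)) (hDc : D c = 0)
    (hpos : ∃ᶠ a in Filter.atBot, 0 < N a)
    (hcross : ∀ y z, y < z → z < c → N y = 0 → N z = 0 → deriv N y ≤ 0 → deriv N z < 0)
    (hx : x < c) : 0 ≤ D x := by
  by_contra! hneg
  have hcont : Continuous D := continuous_iff_continuousAt.2 fun x => (hD x).continuousAt
  have hslope {s t : ℝ} (hst : s < t) : ∃ b ∈ Set.Ioo s t, N b / w b = (D t - D s) / (t - s) :=
    exists_hasDerivAt_eq_slope D _ hst hcont.continuousOn fun x _ => hD x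
  obtain ⟨b, hbx, hNb⟩ : ∃ b < x, N b < 0 := by
    obtain ⟨s, hDs, hsx⟩ := ((hlim.eventually_const_lt hneg).and
      (Filter.eventually_lt_atBot x)).exists
    obtain ⟨b, hb, heq⟩ := hslope hsx
    refine ⟨b, hb.2, neg_of_div_neg_left ?_ (hw b).le⟩
    rw [heq]
    exact div_neg_of_neg_of_pos (sub_neg.2 hDs) (sub_pos.2 hsx)
  obtain ⟨e, hxe, hec, hNe⟩ : ∃ e, x < e ∧ e < c ∧ 0 < N e := by
    obtain ⟨e, he, heq⟩ := hslope hx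
    refine ⟨e, he.1, he.2, (div_pos_iff_of_pos_right (hw e)).1 ?_⟩
    rw [heq, hDc]
    exact div_pos (sub_pos.2 hneg) (sub_pos.2 hx)
  obtain ⟨a, hNa, hab⟩ := (hpos.and_eventually (Filter.eventually_lt_atBot b)).exists
  obtain ⟨y, hy, hNy, hy'⟩ := exists_zero_deriv_nonpos hN hab.le hNa.le hNb
  obtain ⟨z, hz, hNz, hz'⟩ := exists_zero_deriv_nonneg hN (hbx.trans hxe).le hNb.le hNe
  exact (hcross y z (hy.2.trans_le hz.1) (hz.2.trans hec) hNy hNz hy').not_ge hz'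

/-- The sum `∑_{j ≤ k} j ^ m c_j e^{j x}`: the `m`-th derivative of `x ↦ ∑_{j ≤ k} c_j e^{j x}`. -/
noncomputable def expMoment (c : ℕ → ℝ) (k m : ℕ) (x : ℝ) : ℝ :=
  ∑ j ∈ Finset.range (k + 1), (j : ℝ) ^ m * c j * Real.exp (j * x)

/-- The gap `p log (1 + e^{l x}) - log ∑_{j ≤ k} c_j e^{j x}`, whose sign decides a two-point
inequality in the variable `e^x`. -/
noncomputable def logGap (c : ℕ → ℝ) (k : ℕ) (p l x : ℝ) : ℝ :=
  p * Real.log (1 + Real.exp (l * x)) - Real.log (expMoment c k 0 x)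

/-- The numerator of the derivative of `logGap c k p l` when `p l = k`. -/
noncomputable def logGapNum (c : ℕ → ℝ) (k : ℕ) (l x : ℝ) : ℝ :=
  k * Real.exp (l * x) * expMoment c k 0 x - (1 + Real.exp (l * x)) * expMoment c k 1 x

theorem hasDerivAt_exp_const_mul (l x : ℝ) :
    HasDerivAt (fun x => Real.exp (l * x)) (l * Real.exp (l * x)) x :=
  ((hasDerivAt_id' x).const_mul l).exp.congr_deriv (by ring)

theorem tendsto_exp_const_mul_atBot {l : ℝ} (hl : 0 < l) :
    Filter.Tendsto (fun x => Real.exp (l * x)) Filter.atBot (nhds 0) :=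
  Real.tendsto_exp_atBot.comp (Filter.tendsto_id.const_mul_atBot hl)

section ExpMoment

variable {c : ℕ → ℝ} {k : ℕ} {p l : ℝ}

theorem hasDerivAt_expMoment (m : ℕ) (x : ℝ) :
    HasDerivAt (expMoment c k m) (expMoment c k (m + 1) x) x :=
  HasDerivAt.fun_sum fun j _ =>
    ((hasDerivAt_exp_const_mul j x).const_mul (j ^ m * c j)).congr_deriv (by ring)

theorem expMoment_zero_log {t : ℝ} (ht : 0 < t) :
    expMoment c k 0 (Real.log t) = ∑ j ∈ Finset.range (k + 1), c j * t ^ j := by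
  refine Finset.sum_congr rfl fun j _ => ?_
  rw [← Real.log_pow, Real.exp_log (pow_pos ht j), pow_zero, one_mul]

theorem expMoment_nonneg (hc : ∀ j, 0 ≤ c j) (m : ℕ) (x : ℝ) : 0 ≤ expMoment c k m x :=
  Finset.sum_nonneg fun j _ => mul_nonneg (mul_nonneg (by positivity) (hc j)) (Real.exp_nonneg _)

theorem one_le_expMoment_zero (hc : ∀ j, 0 ≤ c j) (hc0 : c 0 = 1) (x : ℝ) :
    1 ≤ expMoment c k 0 x := by
  have hterm := Finset.single_le_sum (f := fun j : ℕ => (j : ℝ) ^ 0 * c j * Real.exp (j * x))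
    (fun j _ => mul_nonneg (mul_nonneg (by positivity) (hc j)) (Real.exp_nonneg _))
    (Finset.mem_range.2 k.succ_pos)
  simpa [expMoment, hc0] using hterm

theorem tendsto_expMoment_zero_atBot (hc0 : c 0 = 1) :
    Filter.Tendsto (expMoment c k 0) Filter.atBot (nhds 1) := by
  have hlim : Filter.Tendsto (expMoment c k 0) Filter.atBot
      (nhds (∑ j ∈ Finset.range (k + 1), if j = 0 then 1 else 0)) := by
    refine tendsto_finsetSum _ fun j _ => ?_
    rcases Nat.eq_zero_or_pos j with rfl | hj
    · simp [hc0]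
    · simpa [hj.ne'] using
        (tendsto_exp_const_mul_atBot (Nat.cast_pos.2 hj)).const_mul (c j)
  simpa using hlim

theorem expMoment_one_le_mul_exp (hc : ∀ j, 0 ≤ c j) {x : ℝ} (hx : x ≤ 0) :
    expMoment c k 1 x ≤ expMoment c k 1 0 * Real.exp x := by
  simp only [expMoment, Finset.sum_mul, pow_one, mul_zero, Real.exp_zero, mul_one]
  refine Finset.sum_le_sum fun j _ => ?_
  rcases Nat.eq_zero_or_pos j with rfl | hj
  · simp
  · have hjx : (j : ℝ) * x ≤ x := mul_le_of_one_le_left hx (Nat.one_le_cast.2 hj)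
    exact mul_le_mul_of_nonneg_left (Real.exp_le_exp.2 hjx) (mul_nonneg j.cast_nonneg (hc j))

theorem hasDerivAt_logGapNum (x : ℝ) : HasDerivAt (logGapNum c k l)
    (k * (l * Real.exp (l * x)) * expMoment c k 0 x
      + k * Real.exp (l * x) * expMoment c k 1 x
      - (l * Real.exp (l * x) * expMoment c k 1 x
        + (1 + Real.exp (l * x)) * expMoment c k 2 x)) x :=
  (((hasDerivAt_exp_const_mul l x).const_mul (k : ℝ)).mul (hasDerivAt_expMoment 0 x)).sub
    (((hasDerivAt_exp_const_mul l x).const_add 1).mul (hasDerivAt_expMoment 1 x))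

theorem hasDerivAt_logGap (hc : ∀ j, 0 ≤ c j) (hc0 : c 0 = 1) (hpl : p * l = k) (x : ℝ) :
    HasDerivAt (logGap c k p l)
      (logGapNum c k l x / ((1 + Real.exp (l * x)) * expMoment c k 0 x)) x := by
  have hv : 1 + Real.exp (l * x) ≠ 0 := by positivity
  have hS : expMoment c k 0 x ≠ 0 := (one_pos.trans_le (one_le_expMoment_zero hc hc0 x)).ne'
  refine (((((hasDerivAt_exp_const_mul l x).const_add 1).log hv).const_mul p).sub
    ((hasDerivAt_expMoment 0 x).log hS)).congr_deriv ?_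
  rw [logGapNum, ← hpl]
  field_simp

theorem tendsto_logGap_atBot (hc0 : c 0 = 1) (hl : 0 < l) :
    Filter.Tendsto (logGap c k p l) Filter.atBot (nhds 0) := by
  have hv := ((tendsto_exp_const_mul_atBot hl).const_add 1).log (by norm_num)
  have hS := (tendsto_expMoment_zero_atBot (k := k) hc0).log one_ne_zero
  simpa using! (hv.const_mul p).sub hS

theorem eventually_logGapNum_pos_atBot (hc : ∀ j, 0 ≤ c j) (hc0 : c 0 = 1) (hk : k ≠ 0)
    (hl0 : 0 ≤ l) (hl1 : l < 1) : ∀ᶠ x in Filter.atBot, 0 < logGapNum c k l x := by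
  have hlim := (tendsto_exp_const_mul_atBot (sub_pos.2 hl1)).const_mul (2 * expMoment c k 1 0)
  rw [mul_zero] at hlim
  filter_upwards [hlim.eventually_lt_const (Nat.cast_pos.2 (Nat.pos_of_ne_zero hk)),
    Filter.eventually_le_atBot 0] with x hlt hx
  have hv : 0 < Real.exp (l * x) := Real.exp_pos _
  have hsmall : (1 + Real.exp (l * x)) * expMoment c k 1 x < k * Real.exp (l * x) :=
    calc (1 + Real.exp (l * x)) * expMoment c k 1 x
        ≤ 2 * (expMoment c k 1 0 * Real.exp x) := by
          refine mul_le_mul ?_ (expMoment_one_le_mul_exp hc hx) (expMoment_nonneg hc 1 x)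
            zero_le_two
          have := Real.exp_le_one_iff.2 (mul_nonpos_of_nonneg_of_nonpos hl0 hx)
          linarith
      _ = 2 * expMoment c k 1 0 * Real.exp ((1 - l) * x) * Real.exp (l * x) := by
          rw [mul_assoc _ (Real.exp _), ← Real.exp_add, mul_assoc]
          ring_nf
      _ < k * Real.exp (l * x) := mul_lt_mul_of_pos_right hlt hv
  exact sub_pos.2 (hsmall.trans_le
    (le_mul_of_one_le_right (by positivity) (one_le_expMoment_zero hc hc0 x)))

end ExpMoment

/-- The squared binomial coefficients, the weights in the `L²` norm of `(1 + e^{iθ})^k`. -/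
def chooseSq (k j : ℕ) : ℝ := (k.choose j : ℝ) ^ 2

theorem chooseSq_nonneg (k j : ℕ) : 0 ≤ chooseSq k j := sq_nonneg _

theorem chooseSq_zero (k : ℕ) : chooseSq k 0 = 1 := by simp [chooseSq]

theorem sq_mul_chooseSq_succ {k j : ℕ} (hj : j ≤ k) :
    ((j + 1 : ℕ) : ℝ) ^ 2 * chooseSq k (j + 1) = ((k : ℝ) - j) ^ 2 * chooseSq k j := by
  have hchoose : ((k.choose (j + 1) * (j + 1) : ℕ) : ℝ) = (k.choose j * (k - j) : ℕ) :=
    congrArg Nat.cast (Nat.choose_succ_right_eq k j)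
  rw [Nat.cast_mul, Nat.cast_mul, Nat.cast_sub hj] at hchoose
  rw [chooseSq, chooseSq, ← mul_pow, ← mul_pow, mul_comm, hchoose, mul_comm]

-- The recursion of the weights turns into a second order equation for their generating function.
theorem expMoment_chooseSq_ode (k : ℕ) (x : ℝ) :
    (1 - Real.exp x) * expMoment (chooseSq k) k 2 x
      = k ^ 2 * Real.exp x * expMoment (chooseSq k) k 0 x
        - 2 * k * Real.exp x * expMoment (chooseSq k) k 1 x := by
  have hshift : expMoment (chooseSq k) k 2 x = Real.exp x * ∑ j ∈ Finset.range (k + 1),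
      ((k : ℝ) - j) ^ 2 * chooseSq k j * Real.exp (j * x) := by
    rw [expMoment, Finset.sum_range_succ', Finset.sum_range_succ _ k]
    simp only [Nat.cast_zero, ne_eq, OfNat.ofNat_ne_zero, not_false_eq_true, zero_pow, zero_mul,
      add_zero, sub_self, Finset.mul_sum]
    refine Finset.sum_congr rfl fun j hj => ?_
    have hexp : Real.exp ((j + 1 : ℕ) * x) = Real.exp x * Real.exp (j * x) := by
      rw [← Real.exp_add, Nat.cast_succ, add_one_mul, add_comm]
    rw [sq_mul_chooseSq_succ (Finset.mem_range.1 hj).le, hexp, mul_left_comm]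
  have hexpand : ∑ j ∈ Finset.range (k + 1), ((k : ℝ) - j) ^ 2 * chooseSq k j * Real.exp (j * x)
      = k ^ 2 * expMoment (chooseSq k) k 0 x - 2 * k * expMoment (chooseSq k) k 1 x
        + expMoment (chooseSq k) k 2 x := by
    simp only [expMoment, Finset.mul_sum, ← Finset.sum_sub_distrib, ← Finset.sum_add_distrib]
    exact Finset.sum_congr rfl fun j _ => by ring
  rw [hexpand] at hshift
  linear_combination hshift

theorem two_mul_exp_mul_sinh (x a : ℝ) :
    2 * Real.exp (x / 2) * Real.sinh (a * (-x / 2))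
      = Real.exp ((1 - a) / 2 * x) - Real.exp ((1 + a) / 2 * x) := by
  rw [Real.sinh_eq, mul_comm 2, mul_assoc, mul_div_cancel₀ _ two_ne_zero, mul_sub, ← Real.exp_add,
    ← Real.exp_add]
  ring_nf

theorem deriv_logGapNum_chooseSq {k : ℕ} {l x : ℝ} (hx : logGapNum (chooseSq k) k l x = 0) :
    (1 + Real.exp (l * x)) * (1 - Real.exp x) * deriv (logGapNum (chooseSq k) k l) x
      = k * expMoment (chooseSq k) k 0 x * Real.exp (l * x) * (2 * Real.exp (x / 2))
        * (l * Real.sinh (-x / 2) - k * Real.sinh ((2 * l - 1) * (-x / 2))) := by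
  have hode := expMoment_chooseSq_ode k x
  have hsinh : 2 * Real.exp (x / 2) * Real.sinh (-x / 2) = 1 - Real.exp x := by
    simpa using two_mul_exp_mul_sinh x 1
  have hsinh_l : 2 * Real.exp (x / 2) * Real.sinh ((2 * l - 1) * (-x / 2))
      = Real.exp ((1 - l) * x) - Real.exp (l * x) := by
    rw [two_mul_exp_mul_sinh]
    ring_nf
  have hexp : Real.exp ((1 - l) * x) * Real.exp (l * x) = Real.exp x := by
    rw [← Real.exp_add]
    ring_nf
  rw [logGapNum] at hx
  rw [(hasDerivAt_logGapNum x).deriv]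
  set S₀ := expMoment (chooseSq k) k 0 x
  set v := Real.exp (l * x)
  set u := Real.exp x
  linear_combination (-(1 + v) ^ 2) * hode
    - ((1 - u) * (k - l) * v + 2 * k * u * (1 + v)) * hx + k ^ 2 * S₀ * hexp
    - k * S₀ * v * l * hsinh + k * S₀ * v * k * hsinh_l

theorem sign_deriv_logGapNum_chooseSq {k : ℕ} (hk : k ≠ 0) {l x : ℝ} (hx : x < 0)
    (hNx : logGapNum (chooseSq k) k l x = 0) :
    SignType.sign (deriv (logGapNum (chooseSq k) k l) x)
      = SignType.sign (l - k * (Real.sinh ((2 * l - 1) * (-x / 2)) / Real.sinh (-x / 2))) := by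
  have hk0 : (0 : ℝ) < k := Nat.cast_pos.2 (Nat.pos_of_ne_zero hk)
  have hS : 0 < expMoment (chooseSq k) k 0 x :=
    one_pos.trans_le (one_le_expMoment_zero (chooseSq_nonneg k) (chooseSq_zero k) x)
  have hu : 0 < 1 - Real.exp x := sub_pos.2 (Real.exp_lt_one_iff.2 hx)
  have hsinh : 0 < Real.sinh (-x / 2) := Real.sinh_pos_iff.2 (by linarith)
  have hratio : l * Real.sinh (-x / 2) - k * Real.sinh ((2 * l - 1) * (-x / 2))
      = Real.sinh (-x / 2)
        * (l - k * (Real.sinh ((2 * l - 1) * (-x / 2)) / Real.sinh (-x / 2))) := by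
    rw [mul_sub, mul_left_comm, mul_div_cancel₀ _ hsinh.ne', mul_comm l]
  have hsign := congrArg SignType.sign (deriv_logGapNum_chooseSq hNx)
  have hleft : 0 < (1 + Real.exp (l * x)) * (1 - Real.exp x) :=
    mul_pos (by positivity) hu
  have hright :
      0 < k * expMoment (chooseSq k) k 0 x * Real.exp (l * x) * (2 * Real.exp (x / 2)) :=
    mul_pos (mul_pos (mul_pos hk0 hS) (Real.exp_pos _)) (by positivity)
  rwa [hratio, sign_mul, sign_pos hleft, one_mul, sign_mul, sign_pos hright, one_mul, sign_mul,
    sign_pos hsinh, one_mul] at hsign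

theorem logGap_chooseSq_nonneg {k : ℕ} (hk : k ≠ 0) {p l : ℝ} (hpl : p * l = k)
    (hl0 : 1 / 2 < l) (hl1 : l < 1) (h0 : logGap (chooseSq k) k p l 0 = 0) {x : ℝ} (hx : x < 0) :
    0 ≤ logGap (chooseSq k) k p l x := by
  have hc := chooseSq_nonneg k
  have hc0 := chooseSq_zero k
  refine nonneg_of_tendsto_atBot_of_deriv_single_crossing
    (w := fun x => (1 + Real.exp (l * x)) * expMoment (chooseSq k) k 0 x)
    (fun x => mul_pos (by positivity) (one_pos.trans_le (one_le_expMoment_zero hc hc0 x)))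
    (hasDerivAt_logGap hc hc0 hpl) (fun x => (hasDerivAt_logGapNum x).differentiableAt)
    (tendsto_logGap_atBot hc0 (by linarith)) h0
    (eventually_logGapNum_pos_atBot hc hc0 hk (by linarith) hl1).frequently ?_ hx
  intro y z hyz hz hNy hNz hy
  rw [← sign_nonpos_iff, sign_deriv_logGapNum_chooseSq hk (hyz.trans hz) hNy, sign_nonpos_iff,
    sub_nonpos] at hy
  rw [← sign_eq_neg_one_iff, sign_deriv_logGapNum_chooseSq hk hz hNz, sign_eq_neg_one_iff, sub_neg]
  have hk0 : (0 : ℝ) < k := Nat.cast_pos.2 (Nat.pos_of_ne_zero hk)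
  have hratio := strictAntiOn_sinh_mul_div_sinh (μ := 2 * l - 1) (by linarith) (by linarith)
    (a := -z / 2) (b := -y / 2) (Set.mem_Ioi.2 (by linarith)) (Set.mem_Ioi.2 (by linarith))
    (by linarith)
  exact hy.trans_lt (mul_lt_mul_of_pos_left hratio hk0)

theorem two_pow_lt_choose_two_mul {k : ℕ} (hk : 2 ≤ k) : 2 ^ k < (2 * k).choose k := by
  induction k, hk using Nat.le_induction with
  | base => decide
  | succ n hn ih =>
    rw [← Nat.centralBinom_eq_two_mul_choose] at ih ⊢
    refine lt_of_mul_lt_mul_left (a := n + 1) ?_ (Nat.zero_le _)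
    rw [Nat.succ_mul_centralBinom_succ, pow_succ]
    nlinarith

theorem lt_logb_two_choose {k : ℕ} (hk : 2 ≤ k) :
    (k : ℝ) < Real.logb 2 ((2 * k).choose k) := by
  rw [Real.lt_logb_iff_rpow_lt one_lt_two (Nat.cast_pos.2 (Nat.choose_pos (by lia))),
    Real.rpow_natCast]
  exact_mod_cast two_pow_lt_choose_two_mul hk

theorem logb_two_choose_lt {k : ℕ} (hk : k ≠ 0) :
    Real.logb 2 ((2 * k).choose k) < 2 * k := by
  have hlt := Nat.choose_lt_two_pow (2 * k) k (by lia)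
  rw [Real.logb_lt_iff_lt_rpow one_lt_two (Nat.cast_pos.2 (Nat.choose_pos (by lia)))]
  exact_mod_cast hlt

theorem two_rpow_logb_choose (k : ℕ) :
    (2 : ℝ) ^ Real.logb 2 ((2 * k).choose k) = (2 * k).choose k :=
  Real.rpow_logb two_pos (by norm_num) (Nat.cast_pos.2 (Nat.choose_pos (by lia)))

theorem sum_chooseSq (k : ℕ) :
    ∑ j ∈ Finset.range (k + 1), chooseSq k j = (2 * k).choose k := by
  simp only [chooseSq]
  exact_mod_cast Nat.sum_range_choose_sq k

theorem logGap_chooseSq_zero (k : ℕ) (l : ℝ) :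
    logGap (chooseSq k) k (Real.logb 2 ((2 * k).choose k)) l 0 = 0 := by
  have hS : expMoment (chooseSq k) k 0 0 = (2 * k).choose k := by
    simp [expMoment, sum_chooseSq]
  rw [logGap, hS, mul_zero, Real.exp_zero, one_add_one_eq_two, ← Real.log_rpow two_pos,
    two_rpow_logb_choose, sub_self]

theorem sum_chooseSq_mul_pow_le {k : ℕ} (hk : 2 ≤ k) {p : ℝ}
    (hp : p = Real.logb 2 ((2 * k).choose k)) {t : ℝ} (ht0 : 0 ≤ t) (ht1 : t ≤ 1) :
    ∑ j ∈ Finset.range (k + 1), chooseSq k j * t ^ j ≤ (1 + t ^ (k / p)) ^ p := by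
  have hkp : k < p := hp ▸ lt_logb_two_choose hk
  have hpk : p < 2 * k := hp ▸ logb_two_choose_lt (by lia)
  have hk0 : (0 : ℝ) < k := Nat.cast_pos.2 (by lia)
  have hp0 : 0 < p := hk0.trans hkp
  rcases ht0.eq_or_lt with rfl | ht0
  · rw [Real.zero_rpow (by positivity), Finset.sum_range_succ']
    simp [chooseSq_zero]
  rcases ht1.eq_or_lt with rfl | ht1
  · simp [sum_chooseSq, one_add_one_eq_two, hp, two_rpow_logb_choose]
  have hgap := logGap_chooseSq_nonneg (l := k / p) (by lia) (mul_div_cancel₀ _ hp0.ne')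
    (by rw [div_lt_div_iff₀ two_pos hp0]; linarith) ((div_lt_one hp0).2 hkp)
    (hp ▸ logGap_chooseSq_zero k _) (Real.log_neg ht0 ht1)
  have hS : 0 < expMoment (chooseSq k) k 0 (Real.log t) :=
    one_pos.trans_le (one_le_expMoment_zero (chooseSq_nonneg k) (chooseSq_zero k) _)
  rwa [logGap, sub_nonneg, mul_comm _ (Real.log t), ← Real.rpow_def_of_pos ht0,
    ← Real.log_rpow (by positivity), Real.log_le_log_iff hS (by positivity),
    expMoment_zero_log ht0] at hgap

theorem sum_chooseSq_mul_pow_mul_pow_le {k : ℕ} (hk : 2 ≤ k) {p : ℝ}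
    (hp : p = Real.logb 2 ((2 * k).choose k)) {a b : ℝ} (ha : 0 ≤ a) (hb : 0 ≤ b) :
    ∑ j ∈ Finset.range (k + 1), chooseSq k j * (a ^ (k - j) * b ^ j)
      ≤ (a ^ (k / p) + b ^ (k / p)) ^ p := by
  have hp0 : 0 < p := hp ▸ k.cast_nonneg.trans_lt (lt_logb_two_choose hk)
  wlog hab : b ≤ a generalizing a b
  · rw [add_comm (a ^ _)]
    refine le_trans (le_of_eq ?_) (this hb ha (not_le.1 hab).le)
    rw [← Finset.sum_range_reflect]
    refine Finset.sum_congr rfl fun j hj => ?_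
    have hjk : j ≤ k := Nat.lt_succ_iff.1 (Finset.mem_range.1 hj)
    rw [Nat.add_sub_cancel, chooseSq, chooseSq, Nat.choose_symm hjk, Nat.sub_sub_self hjk,
      mul_comm (a ^ _)]
  rcases ha.eq_or_lt with rfl | ha
  · obtain rfl : b = 0 := le_antisymm hab hb
    refine (Finset.sum_eq_zero fun j hj => ?_).trans_le (by positivity)
    rw [← pow_add, Nat.sub_add_cancel (Nat.lt_succ_iff.1 (Finset.mem_range.1 hj)),
      zero_pow (by lia), mul_zero]
  have hroot : a ^ k = (a ^ (k / p : ℝ)) ^ p := by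
    rw [← Real.rpow_mul ha.le, div_mul_cancel₀ _ hp0.ne', Real.rpow_natCast]
  calc ∑ j ∈ Finset.range (k + 1), chooseSq k j * (a ^ (k - j) * b ^ j)
      = a ^ k * ∑ j ∈ Finset.range (k + 1), chooseSq k j * (b / a) ^ j := by
        rw [Finset.mul_sum]
        refine Finset.sum_congr rfl fun j hj => ?_
        rw [pow_sub₀ a ha.ne' (Nat.lt_succ_iff.1 (Finset.mem_range.1 hj)), div_pow]
        ring
    _ ≤ a ^ k * (1 + (b / a) ^ (k / p)) ^ p :=
        mul_le_mul_of_nonneg_left (sum_chooseSq_mul_pow_le hk hp (div_nonneg hb ha.le)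
          ((div_le_one ha).2 hab)) (pow_nonneg ha.le k)
    _ = (a ^ (k / p) + b ^ (k / p)) ^ p := by
        rw [hroot, ← Real.mul_rpow (by positivity) (by positivity), Real.div_rpow hb ha.le,
          mul_one_add, mul_div_cancel₀ _ (by positivity)]

/-! ### Energies as moments of exponential sums -/

section ExponentialSums

open MeasureTheory UnitAddTorus ComplexConjugate

theorem integral_fourier (n : ℤ) :
    ∫ x : UnitAddCircle, fourier n x = if n = 0 then 1 else 0 := by
  split_ifs with hn
  · simp [hn, measureReal_def]
  · exact integral_eq_zero_of_add_right_eq_neg (fourier_add_half_inv_index hn one_pos)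

theorem integral_mFourier {ι : Type*} [Fintype ι] (n : ι → ℤ) :
    ∫ t, mFourier n t = if n = 0 then 1 else 0 := by
  calc ∫ t, mFourier n t
      = ∏ i, ∫ x : UnitAddCircle, fourier (n i) x :=
        integral_fintype_prod_volume_eq_prod fun i x => fourier (n i) x
    _ = if n = 0 then 1 else 0 := by
        simp only [integral_fourier, Finset.prod_ite_zero, Finset.prod_const_one, Finset.mem_univ,
          true_implies, funext_iff, Pi.zero_apply]

theorem integral_fourier_mul_conj (m n : ℤ) :
    ∫ x : UnitAddCircle, fourier m x * conj (fourier n x) = if m = n then 1 else 0 := by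
  simp only [← fourier_neg, ← fourier_add, integral_fourier, ← sub_eq_add_neg, sub_eq_zero]

theorem integral_mFourier_mul_conj {ι : Type*} [Fintype ι] (m n : ι → ℤ) :
    ∫ t, mFourier m t * conj (mFourier n t) = if m = n then 1 else 0 := by
  simp only [← mFourier_neg, ← mFourier_add, integral_mFourier, ← sub_eq_add_neg, sub_eq_zero]

theorem mFourier_sum {ι κ : Type*} [Fintype ι] (s : Finset κ) (n : κ → ι → ℤ)
    (t : UnitAddTorus ι) : mFourier (∑ i ∈ s, n i) t = ∏ i ∈ s, mFourier (n i) t := by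
  classical
  induction s using Finset.induction_on with
  | empty => simp [mFourier_zero]
  | insert i s hi ih => rw [Finset.sum_insert hi, Finset.prod_insert hi, mFourier_add, ih]

theorem integrable_of_continuous {X E : Type*} [TopologicalSpace X] [CompactSpace X]
    [MeasurableSpace X] [OpensMeasurableSpace X] [NormedAddCommGroup E] {μ : Measure X}
    [IsFiniteMeasureOnCompacts μ] {f : X → E} (hf : Continuous f) : Integrable f μ :=
  hf.integrable_of_hasCompactSupport (HasCompactSupport.of_compactSpace f)

theorem integral_norm_sum_sq_eq {X κ σ : Type*} [TopologicalSpace X] [CompactSpace X]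
    [MeasurableSpace X] [OpensMeasurableSpace X] {μ : Measure X} [IsFiniteMeasureOnCompacts μ]
    [DecidableEq κ] {e : κ → C(X, ℂ)}
    (he : ∀ m n, ∫ x, e m x * conj (e n x) ∂μ = if m = n then 1 else 0)
    (s : Finset σ) (n : σ → κ) (c : σ → ℂ) :
    ((∫ x, ‖∑ i ∈ s, c i * e (n i) x‖ ^ 2 ∂μ : ℝ) : ℂ)
      = ∑ i ∈ s, ∑ j ∈ s, if n i = n j then c i * conj (c j) else 0 := by
  rw [← integral_complex_ofReal]
  simp only [Complex.ofReal_pow, ← Complex.mul_conj', map_sum, Finset.sum_mul_sum]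
  have hint (i j : σ) :
      Integrable (fun x => c i * e (n i) x * conj (c j * e (n j) x)) μ :=
    integrable_of_continuous (by fun_prop)
  rw [integral_finsetSum _ fun i _ => integrable_finsetSum _ fun j _ => hint i j]
  refine Finset.sum_congr rfl fun i _ => ?_
  rw [integral_finsetSum _ fun j _ => hint i j]
  refine Finset.sum_congr rfl fun j _ => ?_
  have hmul (x : X) : c i * e (n i) x * conj (c j * e (n j) x)
      = c i * conj (c j) * (e (n i) x * conj (e (n j) x)) := by
    rw [map_mul, mul_mul_mul_comm]
  simp only [hmul, integral_const_mul, he, mul_ite, mul_one, mul_zero]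

/-- The exponential sum `∑_{a ∈ A} e(a · t)` of a finite set `A` of frequencies, whose moments
are the energies of `A`. -/
noncomputable def expSum {ι : Type*} [Fintype ι] (A : Finset (ι → ℤ)) : C(UnitAddTorus ι, ℂ) :=
  ∑ a ∈ A, mFourier a

theorem expSum_apply {ι : Type*} [Fintype ι] (A : Finset (ι → ℤ)) (t : UnitAddTorus ι) :
    expSum A t = ∑ a ∈ A, mFourier a t := by
  rw [expSum, ContinuousMap.sum_apply]

theorem kAdditiveEnergy_eq_integral {ι : Type*} [Fintype ι] (k : ℕ) (A : Finset (ι → ℤ)) :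
    (kAdditiveEnergy k A : ℝ) = ∫ t, ‖expSum A t‖ ^ (2 * k) := by
  have hpow (t : UnitAddTorus ι) : ‖expSum A t‖ ^ (2 * k)
      = ‖∑ a ∈ Fintype.piFinset fun _ : Fin k => A, 1 * mFourier (∑ i, a i) t‖ ^ 2 := by
    rw [mul_comm 2 k, pow_mul, ← norm_pow, expSum_apply, Finset.sum_pow']
    simp only [mFourier_sum, one_mul]
  simp only [hpow]
  rw [← Complex.ofReal_inj, integral_norm_sum_sq_eq integral_mFourier_mul_conj]
  rw [← Finset.sum_product', ← Finset.sum_filter]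
  simp [kAdditiveEnergy]

theorem integral_unitAddTorus_succ {d : ℕ} {E : Type*} [NormedAddCommGroup E] [NormedSpace ℝ E]
    {f : UnitAddTorus (Fin (d + 1)) → E} (hf : Continuous f) :
    ∫ t, f t = ∫ t : UnitAddTorus (Fin d), ∫ x : UnitAddCircle, f (Fin.cons x t) := by
  rw [← (volume_preserving_piFinSuccAbove (fun _ => UnitAddCircle) 0).symm.integral_comp' f]
  have hcons (z : UnitAddCircle × UnitAddTorus (Fin d)) :
      (MeasurableEquiv.piFinSuccAbove (fun _ => UnitAddCircle) 0).symm z = Fin.cons z.1 z.2 :=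
    Fin.insertNth_zero' z.1 z.2
  simp only [hcons]
  have hcont : Continuous fun z : UnitAddCircle × UnitAddTorus (Fin d) =>
      f (Fin.cons z.1 z.2) := by fun_prop
  exact integral_prod_symm _ (integrable_of_continuous (μ := volume.prod volume) hcont)

theorem expSum_cons {d : ℕ} {A : Finset (Fin (d + 1) → ℤ)} (hA : A ⊆ discreteCube (d + 1))
    (x : UnitAddCircle) (t : UnitAddTorus (Fin d)) :
    expSum A (Fin.cons x t : Fin (d + 1) → UnitAddCircle)
      = expSum (slice 0 A) t + expSum (slice 1 A) t * fourier 1 x := by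
  have hcons (e : ℤ) (a : Fin d → ℤ) : mFourier (Fin.cons e a : Fin (d + 1) → ℤ)
      (Fin.cons x t : Fin (d + 1) → UnitAddCircle) = fourier e x * mFourier a t :=
    Fin.prod_univ_succ _
  simp only [expSum_apply, sum_eq_sum_slice_add_sum_slice hA, hcons, fourier_zero, one_mul,
    Finset.sum_mul, mul_comm (fourier 1 x)]

theorem integral_norm_add_mul_fourier_one_pow (k : ℕ) (u v : ℂ) :
    ∫ x : UnitAddCircle, ‖u + v * fourier 1 x‖ ^ (2 * k)
      = ∑ j ∈ Finset.range (k + 1),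
        chooseSq k j * (‖u‖ ^ (2 * (k - j)) * ‖v‖ ^ (2 * j)) := by
  have hfourier (j : ℕ) (x : UnitAddCircle) : fourier (j : ℤ) x = fourier 1 x ^ j := by
    simp only [fourier_apply, natCast_zsmul, one_zsmul, AddCircle.toCircle_nsmul, Circle.coe_pow]
  have hpow (x : UnitAddCircle) : ‖u + v * fourier 1 x‖ ^ (2 * k)
      = ‖∑ j ∈ Finset.range (k + 1),
        (k.choose j * u ^ (k - j) * v ^ j) * fourier (j : ℤ) x‖ ^ 2 := by
    rw [mul_comm 2 k, pow_mul, ← norm_pow, add_comm u, add_pow]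
    congr 2
    refine Finset.sum_congr rfl fun j _ => ?_
    rw [hfourier, mul_pow]
    ring
  simp only [hpow]
  rw [← Complex.ofReal_inj, integral_norm_sum_sq_eq integral_fourier_mul_conj]
  simp only [Nat.cast_inj, Finset.sum_ite_eq, Complex.mul_conj']
  push_cast
  refine Finset.sum_congr rfl fun j hj => ?_
  rw [if_pos hj]
  simp only [norm_mul, norm_pow, Complex.norm_natCast, chooseSq]
  push_cast
  ring

theorem kAdditiveEnergy_eq_sum_integral_slices {d : ℕ} (k : ℕ) {A : Finset (Fin (d + 1) → ℤ)}
    (hA : A ⊆ discreteCube (d + 1)) :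
    (kAdditiveEnergy k A : ℝ) = ∑ j ∈ Finset.range (k + 1), chooseSq k j
      * ∫ t, ‖expSum (slice 0 A) t‖ ^ (2 * (k - j)) * ‖expSum (slice 1 A) t‖ ^ (2 * j) := by
  rw [kAdditiveEnergy_eq_integral, integral_unitAddTorus_succ (by fun_prop)]
  simp only [expSum_cons hA, integral_norm_add_mul_fourier_one_pow]
  rw [integral_finsetSum _ fun j _ => integrable_of_continuous (by fun_prop)]
  simp only [integral_const_mul]

theorem slice_discreteCube {d : ℕ} {e : ℤ} (he : e = 0 ∨ e = 1) :
    slice e (discreteCube (d + 1)) = discreteCube d := by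
  ext x
  rw [mem_slice, cons_mem_discreteCube]
  exact and_iff_right he

theorem kAdditiveEnergy_discreteCube (k d : ℕ) :
    kAdditiveEnergy k (discreteCube d) = (2 * k).choose k ^ d := by
  induction d with
  | zero => simp [kAdditiveEnergy, discreteCube, Finset.filter_singleton]
  | succ d ih =>
    have hsum := kAdditiveEnergy_eq_sum_integral_slices k (subset_refl (discreteCube (d + 1)))
    rw [slice_discreteCube (Or.inl rfl), slice_discreteCube (Or.inr rfl)] at hsum
    have hterm (j : ℕ) (hj : j ∈ Finset.range (k + 1)) :
        chooseSq k j * ∫ t, ‖expSum (discreteCube d) t‖ ^ (2 * (k - j))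
          * ‖expSum (discreteCube d) t‖ ^ (2 * j)
        = chooseSq k j * ((2 * k).choose k : ℝ) ^ d := by
      simp only [← pow_add, ← mul_add,
        Nat.sub_add_cancel (Nat.lt_succ_iff.1 (Finset.mem_range.1 hj))]
      rw [← kAdditiveEnergy_eq_integral, ih, Nat.cast_pow]
    rw [Finset.sum_congr rfl hterm, ← Finset.sum_mul] at hsum
    rw [sum_chooseSq, ← pow_succ'] at hsum
    exact_mod_cast hsum

theorem integral_rpow_mul_rpow_le {X : Type*} [MeasurableSpace X] {μ : Measure X} {f g : X → ℝ}
    (hf : Integrable f μ) (hg : Integrable g μ) (hf0 : 0 ≤ f) (hg0 : 0 ≤ g) {p q : ℝ}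
    (hp : 0 ≤ p) (hq : 0 ≤ q) (hpq : p + q = 1) :
    ∫ x, f x ^ p * g x ^ q ∂μ ≤ (∫ x, f x ∂μ) ^ p * (∫ x, g x ∂μ) ^ q := by
  have hlint := ENNReal.lintegral_mul_norm_pow_le hf.aemeasurable.ennreal_ofReal
    hg.aemeasurable.ennreal_ofReal hp hq hpq
  rw [← ofReal_integral_eq_lintegral_ofReal hf (ae_of_all _ hf0),
    ← ofReal_integral_eq_lintegral_ofReal hg (ae_of_all _ hg0),
    ENNReal.ofReal_rpow_of_nonneg (integral_nonneg hf0) hp,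
    ENNReal.ofReal_rpow_of_nonneg (integral_nonneg hg0) hq,
    ← ENNReal.ofReal_mul (Real.rpow_nonneg (integral_nonneg hf0) p)] at hlint
  rw [integral_eq_lintegral_of_nonneg_ae
    (ae_of_all _ fun x => mul_nonneg (Real.rpow_nonneg (hf0 x) p) (Real.rpow_nonneg (hg0 x) q))
    ((hf.aemeasurable.pow_const p).mul (hg.aemeasurable.pow_const q)).aestronglyMeasurable]
  refine ENNReal.toReal_le_of_le_ofReal (mul_nonneg (Real.rpow_nonneg (integral_nonneg hf0) p)
    (Real.rpow_nonneg (integral_nonneg hg0) q)) (le_trans (le_of_eq ?_) hlint)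
  refine lintegral_congr fun x => ?_
  rw [ENNReal.ofReal_mul (Real.rpow_nonneg (hf0 x) p), ENNReal.ofReal_rpow_of_nonneg (hf0 x) hp,
    ENNReal.ofReal_rpow_of_nonneg (hg0 x) hq]

theorem integral_norm_expSum_mul_le {ι : Type*} [Fintype ι] (A B : Finset (ι → ℤ)) {j k : ℕ}
    (hk : k ≠ 0) (hj : j ≤ k) :
    ∫ t, ‖expSum A t‖ ^ (2 * (k - j)) * ‖expSum B t‖ ^ (2 * j)
      ≤ ((kAdditiveEnergy k A : ℝ) ^ (1 / k : ℝ)) ^ (k - j)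
        * ((kAdditiveEnergy k B : ℝ) ^ (1 / k : ℝ)) ^ j := by
  have hk0 : (k : ℝ) ≠ 0 := Nat.cast_ne_zero.2 hk
  have hroot (i : ℕ) {y : ℝ} (hy : 0 ≤ y) : (y ^ (1 / k : ℝ)) ^ i = y ^ (i / k : ℝ) := by
    rw [← Real.rpow_natCast, ← Real.rpow_mul hy, one_div_mul_eq_div]
  have hpow (C : Finset (ι → ℤ)) (i : ℕ) (t : UnitAddTorus ι) :
      ‖expSum C t‖ ^ (2 * i) = (‖expSum C t‖ ^ (2 * k)) ^ (i / k : ℝ) := by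
    rw [← Real.rpow_natCast, ← Real.rpow_natCast, ← Real.rpow_mul (norm_nonneg _)]
    congr 1
    push_cast
    field_simp
  simp only [hpow A (k - j), hpow B j]
  rw [hroot _ (Nat.cast_nonneg _), hroot _ (Nat.cast_nonneg _), kAdditiveEnergy_eq_integral,
    kAdditiveEnergy_eq_integral]
  refine integral_rpow_mul_rpow_le (integrable_of_continuous (by fun_prop))
    (integrable_of_continuous (by fun_prop)) (fun t => by positivity) (fun t => by positivity)
    (by positivity) (by positivity) ?_
  rw [← add_div, ← Nat.cast_add, Nat.sub_add_cancel hj, div_self hk0]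

theorem kAdditiveEnergy_le_card_rpow {d k : ℕ} (hk : 2 ≤ k) {A : Finset (Fin d → ℤ)}
    (hA : A ⊆ discreteCube d) :
    (kAdditiveEnergy k A : ℝ) ≤ (A.card : ℝ) ^ Real.logb 2 ((2 * k).choose k) := by
  have hk0 : k ≠ 0 := by lia
  set p := Real.logb 2 ((2 * k).choose k) with hp
  have hp0 : 0 < p := k.cast_nonneg.trans_lt (lt_logb_two_choose hk)
  induction d with
  | zero =>
    rcases A.eq_empty_or_nonempty with rfl | hne
    · have : Nonempty (Fin k) := Fin.pos_iff_nonempty.1 (by lia)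
      simp [kAdditiveEnergy, Real.zero_rpow hp0.ne']
    · obtain ⟨a, rfl⟩ := Finset.card_eq_one.1
        ((Finset.card_le_one_of_subsingleton A).antisymm hne.card_pos)
      simp [kAdditiveEnergy, Finset.filter_singleton]
  | succ d ih =>
    have hcard : A.card = (slice 0 A).card + (slice 1 A).card := by
      simpa only [Finset.card_eq_sum_ones] using sum_eq_sum_slice_add_sum_slice hA fun _ => 1
    have hroot (e : ℤ) :
        ((kAdditiveEnergy k (slice e A) : ℝ) ^ (1 / k : ℝ)) ^ (k / p) ≤ (slice e A).card := by
      rw [← Real.rpow_mul (Nat.cast_nonneg _), one_div_mul_eq_div,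
        div_div_cancel_left' (Nat.cast_ne_zero.2 hk0),
        Real.rpow_inv_le_iff_of_pos (Nat.cast_nonneg _) (Nat.cast_nonneg _) hp0]
      exact ih (slice_subset_discreteCube hA e)
    rw [kAdditiveEnergy_eq_sum_integral_slices k hA, hcard, Nat.cast_add]
    refine (Finset.sum_le_sum fun j hj => mul_le_mul_of_nonneg_left
      (integral_norm_expSum_mul_le _ _ hk0 (Nat.lt_succ_iff.1 (Finset.mem_range.1 hj)))
      (chooseSq_nonneg k j)).trans ?_
    refine (sum_chooseSq_mul_pow_mul_pow_le hk hp (by positivity) (by positivity)).trans ?_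
    exact Real.rpow_le_rpow (by positivity) (add_le_add (hroot 0) (hroot 1)) hp0.le

end ExponentialSums

/-! ### Energy against doubling -/

theorem card_discreteCube (d : ℕ) : (discreteCube d).card = 2 ^ d := by
  simp [discreteCube, Fintype.card_piFinset]

theorem iteratedSumset_discreteCube_subset (k d : ℕ) :
    iteratedSumset k (discreteCube d) ⊆ Fintype.piFinset fun _ => Finset.Icc 0 (k : ℤ) := by
  intro x hx
  simp only [iteratedSumset, discreteCube, Finset.mem_image, Fintype.mem_piFinset,
    Finset.mem_insert, Finset.mem_singleton] at hx
  obtain ⟨a, ha, rfl⟩ := hx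
  have ha01 (j : Fin k) (i : Fin d) : 0 ≤ a j i ∧ a j i ≤ 1 := by
    rcases ha j i with h | h <;> simp [h]
  refine Fintype.mem_piFinset.2 fun i => Finset.mem_Icc.2 ?_
  rw [Finset.sum_apply]
  refine ⟨Finset.sum_nonneg fun j _ => (ha01 j i).1, ?_⟩
  simpa using Finset.sum_le_card_nsmul Finset.univ (fun j => a j i) 1 fun j _ => (ha01 j i).2

theorem card_iteratedSumset_discreteCube {k : ℕ} (hk : k ≠ 0) (d : ℕ) :
    (iteratedSumset k (discreteCube d)).card = (k + 1) ^ d := by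
  apply le_antisymm
  · simpa using Finset.card_le_card (iteratedSumset_discreteCube_subset k d)
  · have hle := card_rpow_le_card_iteratedSumset hk (subset_refl (discreteCube d))
    rw [card_discreteCube, Nat.cast_pow, Nat.cast_two, ← Real.rpow_pow_comm two_pos.le,
      Real.rpow_logb two_pos (by norm_num) (by positivity)] at hle
    exact_mod_cast hle

theorem kAdditiveEnergy_two {G : Type*} [AddCommGroup G] [DecidableEq G] (A : Finset G) :
    kAdditiveEnergy 2 A = Finset.addEnergy A A := by
  refine Finset.card_bij' (fun x _ => ((x.1 0, x.2 0), (x.1 1, x.2 1)))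
    (fun y _ => (![y.1.1, y.2.1], ![y.1.2, y.2.2])) ?_ ?_ ?_ ?_
  · rintro ⟨a, b⟩ h
    simp only [Finset.mem_filter, Finset.mem_product, Fintype.mem_piFinset, Fin.forall_fin_two,
      Fin.sum_univ_two] at h ⊢
    tauto
  · rintro ⟨⟨a, b⟩, c, e⟩ h
    simp only [Finset.mem_filter, Finset.mem_product, Fintype.mem_piFinset, Fin.forall_fin_two,
      Fin.sum_univ_two, Matrix.cons_val_zero, Matrix.cons_val_one] at h ⊢
    tauto
  · rintro ⟨a, b⟩ _
    ext i <;> fin_cases i <;> rfl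
  · rintro ⟨⟨a, b⟩, c, e⟩ _
    rfl

theorem one_lt_succ_div_two {k : ℕ} (hk : 2 ≤ k) : (1 : ℝ) < (k + 1) / 2 := by
  have hk2 : (2 : ℝ) ≤ k := Nat.ofNat_le_cast.2 hk
  linarith

theorem kAdditiveEnergy_le_card_div_rpow {d k : ℕ} (hk : 2 ≤ k) {A : Finset (Fin d → ℤ)}
    (hA : A ⊆ discreteCube d) (hne : A.Nonempty) :
    (kAdditiveEnergy k A : ℝ) ≤ ((iteratedSumset k A).card / A.card : ℝ)
      ^ Real.logb ((k + 1) / 2) ((2 * k).choose k) := by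
  have hcard : (0 : ℝ) < A.card := Nat.cast_pos.2 hne.card_pos
  have hbase := one_lt_succ_div_two hk
  have hchoose : 1 ≤ (2 * k).choose k := Nat.choose_pos (by lia)
  calc (kAdditiveEnergy k A : ℝ)
      ≤ (A.card : ℝ) ^ Real.logb 2 ((2 * k).choose k) := kAdditiveEnergy_le_card_rpow hk hA
    _ = ((A.card : ℝ) ^ Real.logb 2 ((k + 1) / 2))
          ^ Real.logb ((k + 1) / 2) ((2 * k).choose k) := by
        rw [← Real.rpow_mul hcard.le, Real.mul_logb (by positivity) hbase.ne' (by linarith)]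
    _ ≤ ((iteratedSumset k A).card / A.card : ℝ)
          ^ Real.logb ((k + 1) / 2) ((2 * k).choose k) := by
        refine Real.rpow_le_rpow (by positivity) ?_
          (Real.logb_nonneg hbase (Nat.one_le_cast.2 hchoose))
        rw [Real.logb_div (by positivity) two_ne_zero, Real.logb_self_eq_one one_lt_two,
          Real.rpow_sub hcard, Real.rpow_one]
        exact div_le_div_of_nonneg_right (card_rpow_le_card_iteratedSumset (by lia) hA) hcard.le

theorem card_div_rpow_lt_kAdditiveEnergy_discreteCube {d k : ℕ} (hd : d ≠ 0) (hk : 2 ≤ k) {q : ℝ}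
    (hq : q < Real.logb ((k + 1) / 2) ((2 * k).choose k)) :
    ((iteratedSumset k (discreteCube d)).card / (discreteCube d).card : ℝ) ^ q
      < kAdditiveEnergy k (discreteCube d) := by
  have hbase := one_lt_succ_div_two hk
  have hchoose : 0 < (2 * k).choose k := Nat.choose_pos (by lia)
  have hratio : ((iteratedSumset k (discreteCube d)).card / (discreteCube d).card : ℝ)
      = ((k + 1) / 2) ^ d := by
    rw [card_iteratedSumset_discreteCube (by lia), card_discreteCube, div_pow]
    push_cast
    rfl
  rw [hratio, kAdditiveEnergy_discreteCube, Nat.cast_pow]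
  calc (((k + 1) / 2 : ℝ) ^ d) ^ q = (((k + 1) / 2) ^ q) ^ d :=
        (Real.rpow_pow_comm (by positivity) q d).symm
    _ < ((2 * k).choose k : ℝ) ^ d := pow_lt_pow_left₀
        ((Real.lt_logb_iff_rpow_lt hbase (Nat.cast_pos.2 hchoose)).1 hq) (by positivity) hd

theorem mainTheorem5 (d k : ℕ) (hd : 1 ≤ d) (hk : 2 ≤ k) :
    (∀ A : Finset (Fin d → ℤ), A ⊆ discreteCube d → A.Nonempty →
      (kAdditiveEnergy k A : ℝ) ≤
        (((iteratedSumset k A).card : ℝ) / (A.card : ℝ)) ^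
          Real.logb (((k : ℝ) + 1) / 2) ((Nat.choose (2 * k) k : ℕ) : ℝ)) ∧
    (∀ q : ℝ, q < Real.logb (((k : ℝ) + 1) / 2) ((Nat.choose (2 * k) k : ℕ) : ℝ) →
      ∃ A : Finset (Fin d → ℤ), A ⊆ discreteCube d ∧ A.Nonempty ∧
        (((iteratedSumset k A).card : ℝ) / (A.card : ℝ)) ^ q < (kAdditiveEnergy k A : ℝ)) ∧
    (∀ A : Finset (Fin d → ℤ), A ⊆ discreteCube d → A.Nonempty →
      (Finset.addEnergy A A : ℝ) ≤
        (((A + A).card : ℝ) / (A.card : ℝ)) ^ Real.logb (3 / 2 : ℝ) 6) := by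
  refine ⟨fun A hA hne => kAdditiveEnergy_le_card_div_rpow hk hA hne,
    fun q hq => ⟨discreteCube d, subset_rfl, ?_, ?_⟩, fun A hA hne => ?_⟩
  · rw [← Finset.card_pos, card_discreteCube]
    positivity
  · exact card_div_rpow_lt_kAdditiveEnergy_discreteCube (by lia) hk hq
  · have hle := kAdditiveEnergy_le_card_div_rpow le_rfl hA hne
    rw [kAdditiveEnergy_two, iteratedSumset_eq_nsmul, two_nsmul, Nat.cast_two, two_add_one_eq_three,
      show Nat.choose (2 * 2) 2 = 6 from rfl, Nat.cast_ofNat] at hle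
    exact hle
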